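/- Let $R$ be a commutative ring. For finite groups $G,H$, let $B(G,H)$ be the Grothendieck group (for disjoint union) of finite $(G,H)$-bisets, and $RB(G,H)=R\otimes_{\mathbb Z}B(G,H)$. For finite groups $G,H,K$, let $\times_H:RB(G,H)\times RB(H,K)\to RB(G,K)$ be the $R$-bilinear map induced by $(U,V)\mapsto U\times_HV=(U\times V)/H$, where $H$ acts by $(u,v)\cdot h=(uh,h^{-1}v)$; in particular $RB(G,G)$ is an $R$-algebra, with identity element the class of the $(G,G)$-biset $G$. For $L\le G\times H$, let $(G\times H)/L$ be the biset with $a\cdot(g,h)L\cdot b=(ag,b^{-1}h)L$, and set $$p_1(L)=\{g\mid\exists h,\ (g,h)\in L\},\quad p_2(L)=\{h\mid\exists g,\ (g,h)\in L\},\quad k_1(L)=\{g\mid(g,1)\in L\},\quad k_2(L)=\{h\mid(1,h)\in L\}.$$ Let $G$ be a finite group whose order is invertible in $R$, with Frattini subgroup $\Phi(G)$. Let $RB(G)=R\otimes_{\mathbb Z}B(G)$ where $B(G)$ is the Burnside group of finite $G$-sets, and let $\alpha\mapsto\widetilde\alpha$ be the $R$-linear map $RB(G)\to RB(G,G)$ sending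 the class of a $G$-set $X$ to the class of $\widetilde X=G\times X$, with $a(g,x)b=(agb,ax)$. Put $$e_G^G=\frac1{|G|}\sum_{K\le G}|K|\,\mu(K,G)\,[G/K]\in RB(G),\qquad \mathcal E(G)=\widetilde{e_G^G}\,RB(G,G)\,\widetilde{e_G^G},$$ where $\mu$ is the Möbius function of the poset of subgroups of $G$. For $L\le G\times G$ put $Y_L=\widetilde{e_G^G}\,[(G\times G)/L]\,\widetilde{e_G^G}$; for $M\trianglelefteq G$ put $\Delta_M(G)=\{(a,b)\in G\times G\mid ab^{-1}\in M\}$; and for $N\trianglelefteq G$ with $N\le\Phi(G)$ put $$\varphi_N^G=\sum_{\substack{M\trianglelefteq G\\ N\le M\le\Phi(G)}}\mu_{\trianglelefteq G}(N,M)\,Y_{\Delta_M(G)},$$ where $\mu_{\trianglelefteq G}$ is the Möbius function of the poset of normal subgroups of $G$. Theorem. 1. $\mathcal E(G)$ is an algebra with identity element $\widetilde{e_G^G}$, and the elements $\varphi_N^G$, for $N\trianglelefteq G$ with $N\le\Phi(G)$, lie in $\mathcal E(G)$, are orthogonal idempotents, and have sum $\widetilde{e_G^G}$. 2. Let $N\trianglelefteq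 G$ with $N\le\Phi(G)$, and let $H$ be a finite group. (a) If $L\le G\times H$, then $\varphi_N^G\times_G[(G\times H)/L]=0$ unless $p_1(L)=G$ and $k_1(L)\cap\Phi(G)\le N$. (b) If $L'\le H\times G$, then $[(H\times G)/L']\times_G\varphi_N^G=0$ unless $p_2(L')=G$ and $k_2(L')\cap\Phi(G)\le N$. -/

import Mathlib

open scoped TensorProduct

universe u v

namespace DoubleBurnside

/-- A finite set with a left action of the group `M`. -/
structure FinActSet (M : Type u) [Group M] where
  carrier : Type u
  [finite : Finite carrier]
  [action : MulAction M carrier]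

attribute [instance] FinActSet.finite FinActSet.action

section Burnside

variable (M : Type u) [Group M]

/-- Isomorphism of finite `M`-sets. -/
def isoSetoid : Setoid (FinActSet M) where
  r X Y := ∃ e : X.carrier ≃ Y.carrier, ∀ (m : M) (x : X.carrier), e (m • x) = m • e x
  iseqv := {
    refl := fun X => ⟨Equiv.refl _, fun _ _ => rfl⟩
    symm := by
      rintro X Y ⟨e, he⟩
      refine ⟨e.symm, fun m y => ?_⟩
      rw [Equiv.symm_apply_eq, he, Equiv.apply_symm_apply]
    trans := by
      rintro X Y Z ⟨e, he⟩ ⟨f, hf⟩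
      exact ⟨e.trans f, fun m x => by simp [he, hf]⟩ }

/-- Isomorphism classes of finite `M`-sets. -/
def IsoClass : Type (u + 1) := Quotient (isoSetoid M)

variable {M}

/-- The isomorphism class of a finite `M`-set. -/
def IsoClass.mk (X : FinActSet M) : IsoClass M := Quotient.mk (isoSetoid M) X

theorem IsoClass.sound {X Y : FinActSet M} (e : X.carrier ≃ Y.carrier)
    (he : ∀ (m : M) (x : X.carrier), e (m • x) = m • e x) : IsoClass.mk X = IsoClass.mk Y :=
  Quotient.sound (s := isoSetoid M) ⟨e, he⟩

/-- Disjoint union of finite `M`-sets. -/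
def FinActSet.sum (X Y : FinActSet M) : FinActSet M := ⟨X.carrier ⊕ Y.carrier⟩

/-- The empty `M`-set. -/
def FinActSet.empty : FinActSet M where
  carrier := PEmpty
  action := { smul := fun _ x => x, one_smul := fun _ => rfl, mul_smul := fun _ _ _ => rfl }

instance : Zero (IsoClass M) := ⟨IsoClass.mk FinActSet.empty⟩

instance : Add (IsoClass M) where
  add := Quotient.map₂ FinActSet.sum (by
    rintro X X' ⟨e, he⟩ Y Y' ⟨f, hf⟩
    refine ⟨Equiv.sumCongr e f, ?_⟩
    rintro m (x | y)
    · exact congrArg Sum.inl (he m x)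
    · exact congrArg Sum.inr (hf m y))

/-- Isomorphism classes form a commutative monoid under disjoint union. -/
instance : AddCommMonoid (IsoClass M) where
  add_assoc := by
    rintro ⟨X⟩ ⟨Y⟩ ⟨Z⟩
    refine IsoClass.sound (X := (X.sum Y).sum Z) (Y := X.sum (Y.sum Z)) (Equiv.sumAssoc _ _ _) ?_
    rintro m ((x | y) | z) <;> rfl
  zero_add := by
    rintro ⟨X⟩
    refine IsoClass.sound (X := FinActSet.empty.sum X) (Y := X)
      (Equiv.emptySum PEmpty X.carrier) ?_
    rintro m (x | x)
    · exact x.elim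
    · rfl
  add_zero := by
    rintro ⟨X⟩
    refine IsoClass.sound (X := X.sum FinActSet.empty) (Y := X)
      (Equiv.sumEmpty X.carrier PEmpty) ?_
    rintro m (x | x)
    · rfl
    · exact x.elim
  add_comm := by
    rintro ⟨X⟩ ⟨Y⟩
    refine IsoClass.sound (X := X.sum Y) (Y := Y.sum X) (Equiv.sumComm _ _) ?_
    rintro m (x | x) <;> rfl
  nsmul := nsmulRec

theorem IsoClass.mk_add (X Y : FinActSet M) :
    IsoClass.mk X + IsoClass.mk Y = IsoClass.mk (X.sum Y) := rfl

theorem IsoClass.mk_empty : IsoClass.mk (FinActSet.empty : FinActSet M) = 0 := rfl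

variable (M) in
/-- The Burnside group of `M`: the Grothendieck group of finite `M`-sets. -/
abbrev Burnside : Type (u + 1) := Algebra.GrothendieckAddGroup (IsoClass M)

variable (M) in
/-- The Burnside group with coefficients in `R`. -/
abbrev RBurnside (R : Type v) [CommRing R] : Type (max v (u + 1)) := R ⊗[ℤ] Burnside M

/-- The class of a finite `M`-set in the Burnside group with coefficients in `R`. -/
noncomputable def cls (R : Type v) [CommRing R] (X : FinActSet M) : RBurnside M R :=
  (1 : R) ⊗ₜ[ℤ] Algebra.GrothendieckAddGroup.of (IsoClass.mk X)

theorem cls_congr (R : Type v) [CommRing R] {X Y : FinActSet M} (e : X.carrier ≃ Y.carrier)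
    (he : ∀ (m : M) (x : X.carrier), e (m • x) = m • e x) : cls R X = cls R Y := by
  rw [cls, cls, IsoClass.sound e he]

/-- The Burnside group over `R` is spanned by the classes of finite `M`-sets. -/
theorem RBurnside.induction {R : Type v} [CommRing R] {p : RBurnside M R → Prop}
    (hcls : ∀ X, p (cls R X)) (hadd : ∀ a b, p a → p b → p (a + b))
    (hsmul : ∀ (r : R) a, p a → p (r • a)) (a : RBurnside M R) : p a := by
  induction a using TensorProduct.induction_on with
  | zero => simpa using hsmul 0 _ (hcls FinActSet.empty)
  | add a b ha hb => exact hadd a b ha hb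
  | tmul r x =>
    have h1 : ∀ x : Burnside M, p ((1 : R) ⊗ₜ[ℤ] x) := by
      intro x
      induction x using AddLocalization.ind with
      | _ y =>
        obtain ⟨m, s, hs⟩ := y
        obtain ⟨X, rfl⟩ : ∃ X, m = IsoClass.mk X := ⟨m.out, (Quotient.out_eq m).symm⟩
        obtain ⟨Y, rfl⟩ : ∃ Y, s = IsoClass.mk Y := ⟨s.out, (Quotient.out_eq s).symm⟩
        have : (AddLocalization.mk (IsoClass.mk X) ⟨IsoClass.mk Y, hs⟩ : Burnside M)
            = Algebra.GrothendieckAddGroup.of (IsoClass.mk X)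
              - Algebra.GrothendieckAddGroup.of (IsoClass.mk Y) := by
          change _ = AddLocalization.mk _ 0 - AddLocalization.mk _ 0
          rw [Algebra.GrothendieckAddGroup.mk_sub_mk]
          simp
        rw [this, TensorProduct.tmul_sub, sub_eq_add_neg]
        refine hadd _ _ (hcls X) ?_
        have := hsmul (-1) _ (hcls Y)
        rwa [neg_one_smul] at this
    have := hsmul r _ (h1 x)
    rwa [TensorProduct.smul_tmul', smul_eq_mul, mul_one] at this

end Burnside

section Functoriality

/-- The `R`-linear map between Burnside groups induced by a functorial construction
on finite sets with group action that preserves disjoint unions. -/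
noncomputable def linearize (R : Type v) [CommRing R] {M N : Type u} [Group M] [Group N]
    (f : IsoClass M →+ IsoClass N) : RBurnside M R →ₗ[R] RBurnside N R :=
  LinearMap.baseChange R (Algebra.GrothendieckAddGroup.lift
    (Algebra.GrothendieckAddGroup.of.comp f)).toIntLinearMap

theorem lift_of {A B : Type*} [AddCommMonoid A] [AddCommGroup B] (f : A →+ B) (a : A) :
    Algebra.GrothendieckAddGroup.lift f (Algebra.GrothendieckAddGroup.of a) = f a :=
  DFunLike.congr_fun (Algebra.GrothendieckAddGroup.lift.symm_apply_apply f) a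

theorem linearize_cls (R : Type v) [CommRing R] {M N : Type u} [Group M] [Group N]
    (f : IsoClass M →+ IsoClass N) (X : FinActSet M) (Y : FinActSet N)
    (h : f (IsoClass.mk X) = IsoClass.mk Y) : linearize R f (cls R X) = cls R Y := by
  rw [linearize, cls, LinearMap.baseChange_tmul, AddMonoidHom.coe_toIntLinearMap, lift_of,
    AddMonoidHom.comp_apply, h, cls]

/-- The biadditive extension to Burnside groups of a biadditive map on isomorphism classes. -/
noncomputable def bilift {M N P : Type u} [Group M] [Group N] [Group P]
    (f : IsoClass M →+ IsoClass N →+ IsoClass P) : Burnside M →+ Burnside N →+ Burnside P :=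
  Algebra.GrothendieckAddGroup.lift
    { toFun := fun x =>
        Algebra.GrothendieckAddGroup.lift (Algebra.GrothendieckAddGroup.of.comp (f x))
      map_zero' := by
        rw [← Equiv.eq_symm_apply]
        ext x
        simp
      map_add' := fun x y => by
        rw [← Equiv.eq_symm_apply]
        ext z
        change _ = (_ + _ : Burnside N →+ Burnside P) (Algebra.GrothendieckAddGroup.of z)
        rw [AddMonoidHom.add_apply, lift_of, lift_of]
        simp }

/-- The `R`-bilinear extension to Burnside groups over `R` of a biadditive map on
isomorphism classes. -/
noncomputable def bilinearize (R : Type v) [CommRing R] {M N P : Type u} [Group M] [Group N]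
    [Group P] (f : IsoClass M →+ IsoClass N →+ IsoClass P) :
    RBurnside M R →ₗ[R] RBurnside N R →ₗ[R] RBurnside P R :=
  LinearMap.liftBaseChange R
    { toFun := fun x => LinearMap.baseChange R (bilift f x).toIntLinearMap
      map_add' := fun x y => by
        ext z
        simp [TensorProduct.tmul_add]
      map_smul' := fun n x => by
        ext z
        simp }

theorem bilinearize_cls (R : Type v) [CommRing R] {M N P : Type u} [Group M] [Group N]
    [Group P] (f : IsoClass M →+ IsoClass N →+ IsoClass P) (X : FinActSet M) (Y : FinActSet N)
    (Z : FinActSet P) (h : f (IsoClass.mk X) (IsoClass.mk Y) = IsoClass.mk Z) :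
    bilinearize R f (cls R X) (cls R Y) = cls R Z := by
  have : bilift f (Algebra.GrothendieckAddGroup.of (IsoClass.mk X))
      (Algebra.GrothendieckAddGroup.of (IsoClass.mk Y))
      = Algebra.GrothendieckAddGroup.of (IsoClass.mk Z) := by
    rw [bilift, lift_of]
    change Algebra.GrothendieckAddGroup.lift (Algebra.GrothendieckAddGroup.of.comp
      (f (IsoClass.mk X))) (Algebra.GrothendieckAddGroup.of (IsoClass.mk Y)) = _
    rw [lift_of, AddMonoidHom.comp_apply, h]
  rw [bilinearize, cls, cls, LinearMap.liftBaseChange_tmul, one_smul]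
  change LinearMap.baseChange R (bilift f (Algebra.GrothendieckAddGroup.of
    (IsoClass.mk X))).toIntLinearMap (1 ⊗ₜ[ℤ] Algebra.GrothendieckAddGroup.of (IsoClass.mk Y)) = _
  rw [LinearMap.baseChange_tmul, AddMonoidHom.coe_toIntLinearMap, this, cls]

end Functoriality

section Bisets

/-- A finite `(G, H)`-biset, that is, a finite `G × Hᵐᵒᵖ`-set: the pair `(g, op h)` acts
by `u ↦ g u h`. -/
abbrev Biset (G H : Type u) [Group G] [Group H] := FinActSet (G × Hᵐᵒᵖ)

variable {G H K K' : Type u} [Group G] [Group H] [Group K] [Group K']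

/-- The left action `g u` on a biset. -/
def Biset.left (U : Biset G H) (g : G) (u : U.carrier) : U.carrier :=
  ((g, 1) : G × Hᵐᵒᵖ) • u

/-- The right action `u h` on a biset. -/
def Biset.right (U : Biset G H) (u : U.carrier) (h : H) : U.carrier :=
  ((1, MulOpposite.op h) : G × Hᵐᵒᵖ) • u

theorem Biset.smul_eq (U : Biset G H) (m : G × Hᵐᵒᵖ) (u : U.carrier) :
    m • u = U.left m.1 (U.right u m.2.unop) := by
  simp [Biset.left, Biset.right, smul_smul]

@[simp] theorem Biset.left_one (U : Biset G H) (u : U.carrier) : U.left 1 u = u :=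
  one_smul (G × Hᵐᵒᵖ) u

@[simp] theorem Biset.right_one (U : Biset G H) (u : U.carrier) : U.right u 1 = u :=
  one_smul (G × Hᵐᵒᵖ) u

theorem Biset.left_left (U : Biset G H) (a b : G) (u : U.carrier) :
    U.left a (U.left b u) = U.left (a * b) u := by
  simp [Biset.left, smul_smul]

theorem Biset.right_right (U : Biset G H) (u : U.carrier) (a b : H) :
    U.right (U.right u a) b = U.right u (a * b) := by
  simp [Biset.right, smul_smul]

theorem Biset.left_right (U : Biset G H) (a : G) (b : H) (u : U.carrier) :
    U.left a (U.right u b) = U.right (U.left a u) b := by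
  simp [Biset.left, Biset.right, smul_smul]

/-- Build a biset from commuting left and right actions. -/
def Biset.ofActions (X : Type u) [Finite X] (l : G → X → X) (r : X → H → X)
    (l1 : ∀ x, l 1 x = x) (lm : ∀ a b x, l (a * b) x = l a (l b x))
    (r1 : ∀ x, r x 1 = x) (rm : ∀ a b x, r x (a * b) = r (r x a) b)
    (lr : ∀ a x b, l a (r x b) = r (l a x) b) : Biset G H where
  carrier := X
  action :=
    { smul := fun m x => l m.1 (r x m.2.unop)
      one_smul := fun x => by
        change l 1 (r x 1) = x
        rw [r1, l1]
      mul_smul := fun m n x => by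
        change l (m.1 * n.1) (r x (n.2.unop * m.2.unop)) = l m.1 (r (l n.1 (r x n.2.unop)) m.2.unop)
        rw [lm, rm, lr n.1] }

/-- The relation on `U × V` whose quotient is `U ×_H V`: the orbits of the right action
`(u, v) · h = (u h, h⁻¹ v)`. -/
def tensorSetoid (U : Biset G H) (V : Biset H K) : Setoid (U.carrier × V.carrier) where
  r p q := ∃ h : H, q = (U.right p.1 h, V.left h⁻¹ p.2)
  iseqv := {
    refl := fun p => ⟨1, by simp⟩
    symm := by
      rintro p q ⟨h, rfl⟩
      exact ⟨h⁻¹, by simp [Biset.right_right, Biset.left_left]⟩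
    trans := by
      rintro p q r ⟨h, rfl⟩ ⟨k, rfl⟩
      exact ⟨h * k, by simp [Biset.right_right, Biset.left_left]⟩ }

/-- The product `U ×_H V` of bisets, with action `g [u, v] k = [g u, v k]`. -/
def Biset.tensor (U : Biset G H) (V : Biset H K) : Biset G K :=
  haveI : Finite (Quotient (tensorSetoid U V)) := Quotient.finite _
  Biset.ofActions (Quotient (tensorSetoid U V))
    (fun g => Quotient.map (fun p => (U.left g p.1, p.2)) (by
      rintro p q ⟨h, rfl⟩
      exact ⟨h, by simp [Biset.left_right]⟩))
    (fun x k => Quotient.map (fun p => (p.1, V.right p.2 k)) (by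
      rintro p q ⟨h, rfl⟩
      exact ⟨h, by simp [Biset.left_right]⟩) x)
    (by rintro ⟨u, v⟩; exact congrArg (Quotient.mk _) (Prod.ext (U.left_one u) rfl))
    (by rintro a b ⟨u, v⟩; exact congrArg (Quotient.mk _) (Prod.ext (U.left_left a b u).symm rfl))
    (by rintro ⟨u, v⟩; exact congrArg (Quotient.mk _) (Prod.ext rfl (V.right_one v)))
    (by rintro a b ⟨u, v⟩; exact congrArg (Quotient.mk _) (Prod.ext rfl (V.right_right v a b).symm))
    (by rintro a ⟨u, v⟩ b; rfl)

/-- The class `[u, v]` in `U ×_H V`. -/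
def Biset.pair (U : Biset G H) (V : Biset H K) (u : U.carrier) (v : V.carrier) :
    (U.tensor V).carrier := Quotient.mk (tensorSetoid U V) (u, v)

theorem Biset.smul_pair (U : Biset G H) (V : Biset H K) (m : G × Kᵐᵒᵖ) (u : U.carrier)
    (v : V.carrier) :
    m • U.pair V u v = U.pair V (U.left m.1 u) (V.right v m.2.unop) := rfl

theorem Biset.pair_swap (U : Biset G H) (V : Biset H K) (u : U.carrier) (h : H)
    (v : V.carrier) : U.pair V (U.right u h) v = U.pair V u (V.left h v) :=
  (Quotient.sound (s := tensorSetoid U V) ⟨h, by simp [Biset.left_left]⟩ :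
    U.pair V u (V.left h v) = U.pair V (U.right u h) v).symm

theorem Biset.tensor_ind {U : Biset G H} {V : Biset H K} {p : (U.tensor V).carrier → Prop}
    (h : ∀ u v, p (U.pair V u v)) (x : (U.tensor V).carrier) : p x := by
  obtain ⟨u, v⟩ := x
  exact h u v

/-- Maps out of `U ×_H V` are the `H`-balanced maps out of `U × V`. -/
def Biset.tensorLift {U : Biset G H} {V : Biset H K} {X : Type*} (f : U.carrier → V.carrier → X)
    (hf : ∀ u h v, f (U.right u h) v = f u (V.left h v)) (x : (U.tensor V).carrier) : X :=
  Quotient.lift (s := tensorSetoid U V) (fun p => f p.1 p.2) (by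
    rintro p q ⟨h, rfl⟩
    simp [hf, Biset.left_left]) x

theorem Biset.tensor_congr {U U' : Biset G H} {V V' : Biset H K}
    (hU : IsoClass.mk U = IsoClass.mk U') (hV : IsoClass.mk V = IsoClass.mk V') :
    IsoClass.mk (U.tensor V) = IsoClass.mk (U'.tensor V') := by
  obtain ⟨e, he⟩ := Quotient.exact (s := isoSetoid _) hU
  obtain ⟨f, hf⟩ := Quotient.exact (s := isoSetoid _) hV
  refine IsoClass.sound (X := U.tensor V) (Y := U'.tensor V')
    (Quotient.congr (Equiv.prodCongr e f) ?_) ?_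
  · intro p q
    constructor
    · rintro ⟨h, rfl⟩
      exact ⟨h, Prod.ext (he _ _) (hf _ _)⟩
    · rintro ⟨h, hh⟩
      refine ⟨h, Prod.ext (e.injective ?_) (f.injective ?_)⟩
      · exact (congrArg Prod.fst hh).trans (he _ _).symm
      · exact (congrArg Prod.snd hh).trans (hf _ _).symm
  · intro m x
    induction x using Biset.tensor_ind with
    | h u v => exact congrArg (Quotient.mk _) (Prod.ext (he _ _) (hf _ _))

theorem Biset.sum_tensor (U U' : Biset G H) (V : Biset H K) :
    IsoClass.mk (Biset.tensor (U.sum U') V)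
      = IsoClass.mk (U.tensor V) + IsoClass.mk (U'.tensor V) := by
  refine IsoClass.sound (X := Biset.tensor (U.sum U') V)
    (Y := (U.tensor V).sum (U'.tensor V))
    { toFun := Biset.tensorLift (fun u v =>
        Sum.map (fun a => U.pair V a v) (fun a => U'.pair V a v) u) ?_
      invFun := Sum.elim
        (Biset.tensorLift (fun u v => Biset.pair (U.sum U') V (Sum.inl u) v) ?_)
        (Biset.tensorLift (fun u v => Biset.pair (U.sum U') V (Sum.inr u) v) ?_)
      left_inv := ?_
      right_inv := ?_ } ?_
  · rintro (u | u) h v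
    · exact congrArg Sum.inl (U.pair_swap V u h v)
    · exact congrArg Sum.inr (U'.pair_swap V u h v)
  · exact fun u h v => Biset.pair_swap (U.sum U') V (Sum.inl u) h v
  · exact fun u h v => Biset.pair_swap (U.sum U') V (Sum.inr u) h v
  · intro x
    induction x using Biset.tensor_ind with
    | h u v => rcases u with u | u <;> rfl
  · rintro (x | x) <;> induction x using Biset.tensor_ind with
    | h u v => rfl
  · intro m x
    induction x using Biset.tensor_ind with
    | h u v => rcases u with u | u <;> rfl

theorem Biset.tensor_sum (U : Biset G H) (V V' : Biset H K) :
    IsoClass.mk (U.tensor (V.sum V'))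
      = IsoClass.mk (U.tensor V) + IsoClass.mk (U.tensor V') := by
  refine IsoClass.sound (X := U.tensor (V.sum V'))
    (Y := (U.tensor V).sum (U.tensor V'))
    { toFun := Biset.tensorLift (fun u v =>
        Sum.map (fun a => U.pair V u a) (fun a => U.pair V' u a) v) ?_
      invFun := Sum.elim
        (Biset.tensorLift (fun u v => U.pair (V.sum V') u (Sum.inl v)) ?_)
        (Biset.tensorLift (fun u v => U.pair (V.sum V') u (Sum.inr v)) ?_)
      left_inv := ?_
      right_inv := ?_ } ?_
  · rintro u h (v | v)
    · exact congrArg Sum.inl (U.pair_swap V u h v)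
    · exact congrArg Sum.inr (U.pair_swap V' u h v)
  · exact fun u h v => U.pair_swap (V.sum V') u h (Sum.inl v)
  · exact fun u h v => U.pair_swap (V.sum V') u h (Sum.inr v)
  · intro x
    induction x using Biset.tensor_ind with
    | h u v => rcases v with v | v <;> rfl
  · rintro (x | x) <;> induction x using Biset.tensor_ind with
    | h u v => rfl
  · intro m x
    induction x using Biset.tensor_ind with
    | h u v => rcases v with v | v <;> rfl

/-- The biadditive map `([U], [V]) ↦ [U ×_H V]` on isomorphism classes of bisets. -/
def tensorHom (G H K : Type u) [Group G] [Group H] [Group K] :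
    IsoClass (G × Hᵐᵒᵖ) →+ IsoClass (H × Kᵐᵒᵖ) →+ IsoClass (G × Kᵐᵒᵖ) where
  toFun x :=
    { toFun := Quotient.map₂ (sa := isoSetoid _) (sb := isoSetoid _) (sc := isoSetoid _)
        (fun (U : Biset G H) (V : Biset H K) => U.tensor V)
        (fun _ _ hU _ _ hV => Quotient.exact (s := isoSetoid _)
          (Biset.tensor_congr (Quotient.sound (s := isoSetoid _) hU)
            (Quotient.sound (s := isoSetoid _) hV))) x
      map_zero' := by
        obtain ⟨U⟩ := x
        refine IsoClass.sound (X := Biset.tensor U FinActSet.empty) (Y := FinActSet.empty)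
          { toFun := Biset.tensorLift (fun _ v => v) (fun _ _ v => v.elim)
            invFun := fun v => v.elim
            left_inv := ?_
            right_inv := fun v => v.elim } ?_
        · intro x
          induction x using Biset.tensor_ind with
          | h u v => exact v.elim
        · intro m x
          induction x using Biset.tensor_ind with
          | h u v => exact v.elim
      map_add' := by
        obtain ⟨U⟩ := x
        rintro ⟨V⟩ ⟨V'⟩
        exact Biset.tensor_sum U V V' }
  map_zero' := by
    ext ⟨V⟩
    refine IsoClass.sound (X := Biset.tensor FinActSet.empty V) (Y := FinActSet.empty)
      { toFun := Biset.tensorLift (fun u _ => u) (fun u _ _ => u.elim)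
        invFun := fun u => u.elim
        left_inv := ?_
        right_inv := fun u => u.elim } ?_
    · intro x
      induction x using Biset.tensor_ind with
      | h u v => exact u.elim
    · intro m x
      induction x using Biset.tensor_ind with
      | h u v => exact u.elim
  map_add' := by
    rintro ⟨U⟩ ⟨U'⟩
    ext ⟨V⟩
    exact Biset.sum_tensor U U' V

/-- The double Burnside module `RB(G, H) = R ⊗ B(G, H)`. -/
abbrev RB (R : Type v) [CommRing R] (G H : Type u) [Group G] [Group H] :
    Type (max v (u + 1)) := RBurnside (G × Hᵐᵒᵖ) R

variable {R : Type v} [CommRing R]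

/-- The product `×_H : RB(G, H) × RB(H, K) → RB(G, K)`, extending `R`-bilinearly the product
`([U], [V]) ↦ [U ×_H V]` of bisets. -/
noncomputable def prod (a : RB R G H) (b : RB R H K) : RB R G K :=
  bilinearize R (tensorHom G H K) a b

theorem prod_cls (U : Biset G H) (V : Biset H K) :
    prod (cls R U) (cls R V) = cls R (U.tensor V) :=
  bilinearize_cls R _ _ _ _ rfl

theorem add_prod (a a' : RB R G H) (b : RB R H K) : prod (a + a') b = prod a b + prod a' b := by
  simp [prod]

theorem prod_add (a : RB R G H) (b b' : RB R H K) : prod a (b + b') = prod a b + prod a b' := by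
  simp [prod]

theorem zero_prod (b : RB R H K) : prod (0 : RB R G H) b = 0 := by
  simp [prod]

theorem prod_zero (a : RB R G H) : prod a (0 : RB R H K) = 0 := by
  simp [prod]

theorem smul_prod (r : R) (a : RB R G H) (b : RB R H K) : prod (r • a) b = r • prod a b := by
  simp only [prod, map_smul, LinearMap.smul_apply]

theorem prod_smul (r : R) (a : RB R G H) (b : RB R H K) : prod a (r • b) = r • prod a b := by
  simp only [prod, map_smul]

theorem Biset.tensor_assoc (U : Biset G H) (V : Biset H K) (W : Biset K K') :
    cls R ((U.tensor V).tensor W) = cls R (U.tensor (V.tensor W)) := by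
  refine cls_congr R (X := (U.tensor V).tensor W) (Y := U.tensor (V.tensor W))
    { toFun := Biset.tensorLift (fun x w => Biset.tensorLift
        (fun u v => U.pair (V.tensor W) u (V.pair W v w)) ?_ x) ?_
      invFun := Biset.tensorLift (fun u y => Biset.tensorLift
        (fun v w => (U.tensor V).pair W (U.pair V u v) w) ?_ y) ?_
      left_inv := ?_
      right_inv := ?_ } ?_
  · intro u h v
    rw [Biset.pair_swap]
    congr 1
    change V.pair W (V.left h v) (W.right w 1) = _
    rw [Biset.right_one]
  · intro x k w
    induction x using Biset.tensor_ind with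
    | h u v =>
      change U.pair (V.tensor W) (U.left 1 u) (V.pair W (V.right v k) w)
        = U.pair (V.tensor W) u (V.pair W v (W.left k w))
      rw [Biset.left_one, Biset.pair_swap]
  · intro v k w
    rw [← Biset.pair_swap]
    congr 1
    change _ = U.pair V (U.left 1 u) (V.right v k)
    rw [Biset.left_one]
  · intro u h y
    induction y using Biset.tensor_ind with
    | h v w =>
      change (U.tensor V).pair W (U.pair V (U.right u h) v) w
        = (U.tensor V).pair W (U.pair V u (V.left h v)) (W.right w 1)
      rw [Biset.right_one, Biset.pair_swap]
  · intro x
    induction x using Biset.tensor_ind with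
    | h x w =>
      induction x using Biset.tensor_ind with
      | h u v => rfl
  · intro x
    induction x using Biset.tensor_ind with
    | h u y =>
      induction y using Biset.tensor_ind with
      | h v w => rfl
  · intro m x
    induction x using Biset.tensor_ind with
    | h x w =>
      induction x using Biset.tensor_ind with
      | h u v =>
        change U.pair (V.tensor W) (U.left m.1 u)
            (V.pair W (V.right v 1) (W.right w m.2.unop))
          = U.pair (V.tensor W) (U.left m.1 u)
            (V.pair W (V.left 1 v) (W.right w m.2.unop))
        rw [Biset.left_one, Biset.right_one]

theorem prod_assoc (a : RB R G H) (b : RB R H K) (c : RB R K K') :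
    prod (prod a b) c = prod a (prod b c) := by
  induction a using RBurnside.induction with
  | hadd a a' h h' => simp only [add_prod, h, h']
  | hsmul r a h => simp only [smul_prod, h]
  | hcls U =>
    induction b using RBurnside.induction with
    | hadd a a' h h' => simp only [add_prod, prod_add, h, h']
    | hsmul r a h => simp only [smul_prod, prod_smul, h]
    | hcls V =>
      induction c using RBurnside.induction with
      | hadd a a' h h' => simp only [prod_add, h, h']
      | hsmul r a h => simp only [prod_smul, h]
      | hcls W =>
        rw [prod_cls, prod_cls, prod_cls, prod_cls]
        exact Biset.tensor_assoc U V W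

variable (G) in
/-- The set `G`, as a `(G, G)`-biset for left and right multiplication. -/
def Biset.id [Finite G] : Biset G G :=
  Biset.ofActions G (fun a x => a * x) (fun x b => x * b) one_mul mul_assoc mul_one
    (fun a b x => (mul_assoc x a b).symm) (fun a x b => (mul_assoc a x b).symm)

theorem id_prod [Finite G] (a : RB R G H) : prod (cls R (Biset.id G)) a = a := by
  induction a using RBurnside.induction with
  | hadd a a' h h' => simp only [prod_add, h, h']
  | hsmul r a h => simp only [prod_smul, h]
  | hcls U =>
    rw [prod_cls]
    refine cls_congr R (X := (Biset.id G).tensor U) (Y := U)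
      { toFun := Biset.tensorLift (fun (g : G) u => Biset.left U g u) ?_
        invFun := fun u => (Biset.id G).pair U (1 : G) u
        left_inv := ?_
        right_inv := fun u => Biset.left_one U u } ?_
    · intro (g : G) (h : G) u
      change Biset.left U (1 * (g * h)) u = _
      rw [one_mul, Biset.left_left]
    · intro x
      induction x using Biset.tensor_ind with
      | h g u =>
        refine ((Biset.id G).pair_swap U (1 : G) (g : G) u).symm.trans ?_
        congr 1
        exact (one_mul (M := G) _).trans (one_mul (M := G) g)
    · intro m x
      induction x using Biset.tensor_ind with
      | h g u =>
        change Biset.left U (m.1 * ((show G from g) * 1)) (Biset.right U u m.2.unop)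
          = m • Biset.left U (show G from g) u
        rw [Biset.smul_eq, mul_one, ← Biset.left_left, Biset.left_right U g]

theorem prod_id [Finite H] (a : RB R G H) : prod a (cls R (Biset.id H)) = a := by
  induction a using RBurnside.induction with
  | hadd a a' h h' => simp only [add_prod, h, h']
  | hsmul r a h => simp only [smul_prod, h]
  | hcls U =>
    rw [prod_cls]
    refine cls_congr R (X := Biset.tensor U (Biset.id H)) (Y := U)
      { toFun := Biset.tensorLift (fun u (h : H) => Biset.right U u h) ?_
        invFun := fun u => Biset.pair U (Biset.id H) u (1 : H)
        left_inv := ?_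
        right_inv := fun u => Biset.right_one U u } ?_
    · intro u (h : H) (k : H)
      change Biset.right U (Biset.right U u h) k = Biset.right U u (h * (k * 1))
      rw [mul_one, Biset.right_right]
    · intro x
      induction x using Biset.tensor_ind with
      | h u h =>
        refine (Biset.pair_swap U (Biset.id H) u (h : H) (1 : H)).trans ?_
        congr 1
        exact (congrArg (fun k : H => (show H from h) * k) (one_mul (1 : H))).trans
          (mul_one (M := H) h)
    · intro m x
      induction x using Biset.tensor_ind with
      | h u h =>
        change Biset.right U (Biset.left U m.1 u) (1 * ((show H from h) * m.2.unop))
          = m • Biset.right U u (show H from h)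
        rw [Biset.smul_eq, one_mul, ← Biset.left_right, Biset.right_right]

/-- The double Burnside algebra `RB(G, G)`, with product `×_G` and identity the class of `G`. -/
noncomputable instance [Finite G] : Ring (RB R G G) where
  __ := (inferInstance : AddCommGroup (RB R G G))
  mul := prod
  one := cls R (Biset.id G)
  left_distrib := prod_add
  right_distrib := add_prod
  zero_mul := zero_prod
  mul_zero := prod_zero
  mul_assoc := prod_assoc
  one_mul := id_prod
  mul_one := prod_id

theorem mul_eq_prod [Finite G] (a b : RB R G G) : a * b = prod a b := rfl

noncomputable instance [Finite G] : Algebra R (RB R G G) :=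
  Algebra.ofModule smul_prod (fun r a b => prod_smul r a b)

end Bisets

section Transitive

variable {G H : Type u} [Group G] [Group H]

/-- The transitive `G`-set `G/K`. -/
def FinActSet.coset [Finite G] (K : Subgroup G) : FinActSet G := ⟨G ⧸ K⟩

/-- The `(G, H)`-biset `(G × H)/L`, with `a · (g, h)L · b = (a g, b⁻¹ h)L`. -/
def Biset.coset [Finite G] [Finite H] (L : Subgroup (G × H)) : Biset G H where
  carrier := (G × H) ⧸ L
  action := MulAction.compHom _
    ((MonoidHom.id G).prodMap (MulEquiv.inv' H).symm.toMonoidHom : G × Hᵐᵒᵖ →* G × H)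

theorem Biset.coset_smul [Finite G] [Finite H] (L : Subgroup (G × H)) (a g : G) (b h : H) :
    (Biset.coset L).left a ((Biset.coset L).right
      (QuotientGroup.mk (s := L) (g, h)) b) = QuotientGroup.mk (s := L) (a * g, b⁻¹ * h) := by
  exact (Biset.smul_eq (Biset.coset L) (a, MulOpposite.op b)
    (QuotientGroup.mk (s := L) (g, h))).symm

/-- `p₁(L) = {g | ∃ h, (g, h) ∈ L}`. -/
def p₁ (L : Subgroup (G × H)) : Subgroup G := L.map (MonoidHom.fst G H)

/-- `p₂(L) = {h | ∃ g, (g, h) ∈ L}`. -/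
def p₂ (L : Subgroup (G × H)) : Subgroup H := L.map (MonoidHom.snd G H)

/-- `k₁(L) = {g | (g, 1) ∈ L}`. -/
def k₁ (L : Subgroup (G × H)) : Subgroup G := L.comap (MonoidHom.inl G H)

/-- `k₂(L) = {h | (1, h) ∈ L}`. -/
def k₂ (L : Subgroup (G × H)) : Subgroup H := L.comap (MonoidHom.inr G H)

variable (G) in
/-- The normal subgroups of `G`, ordered by inclusion. -/
abbrev NormalSubgroup := {N : Subgroup G // N.Normal}

/-- `Δ_N(G) = {(a, b) | a b⁻¹ ∈ N}`. -/
def diag (N : NormalSubgroup G) : Subgroup (G × G) where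
  carrier := {x | x.1 * x.2⁻¹ ∈ N.1}
  one_mem' := by simp
  mul_mem' := by
    rintro ⟨a, b⟩ ⟨c, d⟩ hab hcd
    have := N.1.mul_mem (N.2.conj_mem _ hcd a) hab
    simpa [mul_assoc] using this
  inv_mem' := by
    rintro ⟨a, b⟩ hab
    have := N.2.conj_mem _ (N.1.inv_mem hab) a⁻¹
    simpa [mul_assoc] using this

end Transitive

section Idempotents

/-- The Möbius function of a finite poset. -/
noncomputable def moebius {P : Type*} [PartialOrder P] [Finite P] (x y : P) : ℤ :=
  open Classical in
  letI : Fintype P := Fintype.ofFinite P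
  letI : LocallyFiniteOrder P := Fintype.toLocallyFiniteOrder
  IncidenceAlgebra.mu ℤ x y

noncomputable instance (G : Type u) [Group G] [Finite G] (p : Subgroup G → Prop) :
    Fintype {K : Subgroup G // p K} := Fintype.ofFinite _

noncomputable instance (G : Type u) [Group G] [Finite G] (p : NormalSubgroup G → Prop) :
    Fintype {N : NormalSubgroup G // p N} := Fintype.ofFinite _

variable (R : Type v) [CommRing R] (G : Type u) [Group G]

/-- The element `e_H^G = |N_G(H)|⁻¹ ∑_{K ≤ H} |K| μ(K, H) [G/K]` of `RB(G)`
(meaningful when `|G|` is invertible in `R`). -/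
noncomputable def burnsideIdempotent [Finite G] (H : Subgroup G) : RBurnside G R :=
  Ring.inverse (Nat.card (Subgroup.normalizer (H : Set G)) : R) •
    ∑ K : {K : Subgroup G // K ≤ H},
      ((Nat.card K.1 : R) * (moebius K.1 H : R)) • cls R (FinActSet.coset K.1)

variable {G} in
/-- The biset `X̃ = G × X` attached to a `G`-set `X`, with `a (g, x) b = (a g b, a x)`. -/
def FinActSet.tilde [Finite G] (X : FinActSet G) : Biset G G :=
  Biset.ofActions (G × X.carrier) (fun a p => (a * p.1, a • p.2)) (fun p b => (p.1 * b, p.2))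
    (by simp) (by simp [mul_assoc, mul_smul]) (by simp) (by simp [mul_assoc])
    (by simp [mul_assoc])

/-- The additive map `[X] ↦ [X̃]` on isomorphism classes. -/
def tildeHom [Finite G] : IsoClass G →+ IsoClass (G × Gᵐᵒᵖ) where
  toFun := Quotient.map (sa := isoSetoid _) (sb := isoSetoid _) FinActSet.tilde (by
    rintro X Y ⟨e, he⟩
    exact ⟨Equiv.prodCongr (Equiv.refl G) e, fun m x => Prod.ext rfl (he _ _)⟩)
  map_zero' := by
    refine IsoClass.sound (X := FinActSet.empty.tilde) (Y := FinActSet.empty)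
      (Equiv.prodPEmpty G) ?_
    rintro m ⟨_, x⟩
    exact x.elim
  map_add' := by
    rintro ⟨X⟩ ⟨Y⟩
    refine IsoClass.sound (X := (X.sum Y).tilde) (Y := FinActSet.sum X.tilde Y.tilde)
      (Equiv.prodSumDistrib G X.carrier Y.carrier) ?_
    rintro m ⟨g, x | x⟩ <;> rfl

/-- The `R`-linear map `RB(G) → RB(G, G)`, `[X] ↦ [X̃]`. -/
noncomputable def tilde [Finite G] : RBurnside G R →ₗ[R] RB R G G := linearize R (tildeHom G)

theorem tilde_cls [Finite G] (X : FinActSet G) : tilde R G (cls R X) = cls R X.tilde :=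
  linearize_cls R _ _ _ rfl

/-- The element `ẽ_G^G` of `RB(G, G)`. -/
noncomputable def eTilde [Finite G] : RB R G G := tilde R G (burnsideIdempotent R G ⊤)

/-- `𝓔(G) = ẽ_G^G RB(G, G) ẽ_G^G`, as a subset of `RB(G, G)` closed under the linear operations
and the product. -/
noncomputable def cutAlgebra [Finite G] : NonUnitalSubalgebra R (RB R G G) where
  carrier := {x | ∃ a, x = eTilde R G * a * eTilde R G}
  add_mem' := by
    rintro _ _ ⟨a, rfl⟩ ⟨b, rfl⟩
    exact ⟨a + b, by rw [mul_add, add_mul]⟩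
  zero_mem' := ⟨0, by rw [mul_zero, zero_mul]⟩
  mul_mem' := by
    rintro _ _ ⟨a, rfl⟩ ⟨b, rfl⟩
    exact ⟨a * eTilde R G * (eTilde R G * b), by simp only [mul_assoc]⟩
  smul_mem' := by
    rintro r _ ⟨a, rfl⟩
    exact ⟨r • a, by rw [mul_smul_comm, smul_mul_assoc]⟩

variable {G}

/-- `Y_L = ẽ_G^G [(G × G)/L] ẽ_G^G`. -/
noncomputable def Y [Finite G] (L : Subgroup (G × G)) : RB R G G :=
  eTilde R G * cls R (Biset.coset L) * eTilde R G

/-- `φ_N^G = ∑ μ(N, M) Y_{Δ_M(G)}`, over the normal subgroups `M` of `G` with `N ≤ M ≤ Φ(G)`, where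
`μ` is the Möbius function of the poset of normal subgroups of `G`. -/
noncomputable def phi [Finite G] (N : NormalSubgroup G) : RB R G G :=
  ∑ M : {M : NormalSubgroup G // N ≤ M ∧ M.1 ≤ frattini G},
    (moebius N M.1 : R) • Y R (diag M.1)

end Idempotents

end DoubleBurnside

open DoubleBurnside

/-! Write `e` for `eTilde R G` and `[L]` for the class of `(G × H)/L`. Everything rests on one
vanishing statement, `eTilde_prod_coset_eq_zero`: `e [L] = 0` as soon as `p₁ L` is proper.
Multiplying `[L]` by the tilde of `X` gives the biset `X × (G × H)/L`, whose orbit decomposition for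
`X = G/K` involves only the intersections of `p₁ L` with conjugates of `K`. Against the coefficients
`μ(K, G)` of `e`, Weisner's theorem makes the total vanish.

Since `e` is `1` plus a combination of classes of diagonals of proper subgroups, the vanishing gives
`e² = e`. If `N ≤ Φ(G)` and `K < G`, then `KN < G`, so the same argument gives `Y_{Δ_N} = e [Δ_N]`,
and also `[Δ_N] e` by passing to opposites. As `Δ_M * Δ_N = Δ_{MN}`, this yields `Y_{Δ_M} Y_{Δ_N} =
Y_{Δ_{MN}}` (`Y_diag_mul`): the `Y_{Δ_M}` multiply like the join semilattice of normal subgroups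
inside `Φ(G)`. The `φ_N` are the Möbius-inverted elements of that semilattice algebra: `φ_N Y_{Δ_Q}`
is `φ_N` if `Q ≤ N` and `0` otherwise, whence orthogonality and the sum.

For the last vanishing, put `Q = k₁(L) ∩ Φ(G)`. Then `[L] = [Δ_Q] [L]`, so `φ_N [L] = φ_N e [Δ_Q]
[L] = φ_N Y_{Δ_Q} [L]`, which is `0` unless `Q ≤ N`. Opposite bisets give the statement on the other
side. -/

namespace DoubleBurnside

/-! ### Möbius functions and Weisner's theorem. -/

section Moebius

/-- `moebius` chooses its own `Fintype` and interval structure; this identity and the next are freed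
of that choice by writing intervals as filters. -/
theorem sum_moebius_right {P : Type*} [PartialOrder P] [Fintype P] (x t : P) :
    (open Classical in ∑ m with x ≤ m ∧ m ≤ t, moebius x m) =
      open Classical in if x = t then 1 else 0 := by
  classical
  let _ : Fintype P := Fintype.ofFinite P
  let _ : LocallyFiniteOrder P := Fintype.toLocallyFiniteOrder
  rw [← IncidenceAlgebra.sum_Icc_mu_right (𝕜 := ℤ) x t]
  refine Finset.sum_congr ?_ fun m _ => ?_
  · ext m
    simp
  · unfold moebius
    congr!

theorem sum_moebius_left {P : Type*} [PartialOrder P] [Fintype P] (t y : P) :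
    (open Classical in ∑ m with t ≤ m ∧ m ≤ y, moebius m y) =
      open Classical in if t = y then 1 else 0 := by
  classical
  let _ : Fintype P := Fintype.ofFinite P
  let _ : LocallyFiniteOrder P := Fintype.toLocallyFiniteOrder
  rw [← IncidenceAlgebra.sum_Icc_mu_left (𝕜 := ℤ) t y]
  refine Finset.sum_congr ?_ fun m _ => ?_
  · ext m
    simp
  · unfold moebius
    congr!

/-- Weisner's theorem, in the form: a function `c` on a finite poset whose sums over the initial
segments of elements above `q` vanish is orthogonal to every function of `m ⊔ q`. -/
theorem sum_smul_join_eq_zero {P A : Type*} [PartialOrder P] [Fintype P] [AddCommGroup A]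
    (c : P → ℤ) (j : P → P) (q : P) (hj : ∀ m t, j m ≤ t ↔ m ≤ t ∧ q ≤ t)
    (hc : open Classical in ∀ t, q ≤ t → ∑ m with m ≤ t, c m = 0) (f : P → A) :
    ∑ m, c m • f (j m) = 0 := by
  classical
  -- It suffices that `c` sums to zero on each fibre of `j`. For `q ≤ t` the initial segment of `t`
  -- is the union of the fibres over `s ≤ t`, so induction leaves only the fibre over `t`; for other
  -- `t` the fibre is empty.
  have hF : ∀ t, ∑ m with j m = t, c m = 0 := by
    intro t
    induction t using WellFoundedLT.induction with
    | ind t ih =>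
      by_cases hq : q ≤ t
      · have h1 : ∑ m with m ≤ t, c m = ∑ s with s ≤ t, ∑ m with j m = s, c m := by
          rw [← Finset.sum_fiberwise_of_maps_to (s := Finset.univ.filter (· ≤ t))
            (t := Finset.univ.filter (· ≤ t)) (g := j)]
          · refine Finset.sum_congr rfl fun s hs => Finset.sum_congr ?_ fun _ _ => rfl
            ext m
            simp only [Finset.mem_filter, Finset.mem_univ, true_and] at hs ⊢
            refine ⟨fun h => h.2, fun h => ⟨?_, h⟩⟩
            subst h
            exact ((hj m t).1 hs).1
          · intro m hm
            simp only [Finset.mem_filter, Finset.mem_univ, true_and] at hm ⊢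
            exact (hj m t).2 ⟨hm, hq⟩
        rw [hc t hq, Finset.sum_eq_single_of_mem t (by simp)] at h1
        · exact h1.symm
        · intro s hs hst
          exact ih s (lt_of_le_of_ne (by simpa using hs) hst)
      · refine Finset.sum_eq_zero fun m hm => ?_
        simp only [Finset.mem_filter, Finset.mem_univ, true_and] at hm
        exact absurd ((hj m t).1 hm.le).2 hq
  rw [← Finset.sum_fiberwise_of_maps_to (s := Finset.univ) (t := Finset.univ) (g := j)
    (fun _ _ => Finset.mem_univ _)]
  refine Finset.sum_eq_zero fun t _ => ?_
  rw [← zero_smul ℤ (f t), ← hF t, Finset.sum_smul]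
  refine Finset.sum_congr rfl fun m hm => ?_
  rw [(Finset.mem_filter.1 hm).2]

/-- Weisner's theorem in the dual order, where meeting with `a` is a join. The hypothesis on
segments holds because any `t ≤ a` differs from `⊤`. -/
theorem sum_moebius_top_smul_inf {L A : Type*} [Lattice L] [OrderTop L] [Fintype L]
    [AddCommGroup A] {a : L} (ha : a ≠ ⊤) (f : L → A) :
    ∑ m : L, moebius m ⊤ • f (m ⊓ a) = 0 := by
  classical
  refine sum_smul_join_eq_zero (P := Lᵒᵈ) (fun m => moebius (OrderDual.ofDual m) ⊤)
    (fun m => OrderDual.toDual (OrderDual.ofDual m ⊓ a)) (OrderDual.toDual a)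
    (fun m t => (le_inf_iff : OrderDual.ofDual t ≤ OrderDual.ofDual m ⊓ a ↔ _)) ?_
    (fun m => f (OrderDual.ofDual m))
  intro t ht
  have h := sum_moebius_left (OrderDual.ofDual t) (⊤ : L)
  have ht' : OrderDual.ofDual t ≠ (⊤ : L) := ne_top_of_le_ne_top ha ht
  rw [if_neg ht'] at h
  refine Eq.trans ?_ h
  refine Finset.sum_bij (fun m _ => OrderDual.ofDual m) ?_ ?_ ?_ ?_
  · intro m hm
    simpa using hm
  · intro m _ m' _ h
    exact h
  · intro m hm
    exact ⟨OrderDual.toDual m, Finset.mem_filter.2 ⟨Finset.mem_univ _,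
      (Finset.mem_filter.1 hm).2.1⟩, rfl⟩
  · intro m _
    rfl

end Moebius

/-! ### Orbit decompositions in the Burnside group. -/

section Orbits

variable {M : Type u} [Group M] (R : Type v) [CommRing R]

theorem cls_sum (X Y : FinActSet M) : cls R (X.sum Y) = cls R X + cls R Y := by
  simp only [cls, ← TensorProduct.tmul_add, ← map_add, IsoClass.mk_add]

theorem cls_of_isEmpty (X : FinActSet M) [IsEmpty X.carrier] : cls R X = 0 := by
  have : cls R X = cls R (FinActSet.empty : FinActSet M) :=
    cls_congr R (X := X) (Y := FinActSet.empty) (Equiv.equivOfIsEmpty X.carrier PEmpty)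
      fun _ x => isEmptyElim x
  rw [this, cls, IsoClass.mk_empty, map_zero, TensorProduct.tmul_zero]

variable {R}

/-- The invariant subset of a finite `M`-set where an invariant function satisfies `p`. -/
def FinActSet.restrict (Z : FinActSet M) {I : Type*} (q : Z.carrier → I)
    (hq : ∀ (m : M) z, q (m • z) = q z) (p : I → Prop) : FinActSet M where
  carrier := {z : Z.carrier // p (q z)}
  action :=
    { smul := fun m z => ⟨m • z.1, (hq m z.1).symm ▸ z.2⟩
      one_smul := fun z => Subtype.ext (one_smul M z.1)
      mul_smul := fun m n z => Subtype.ext (mul_smul m n z.1) }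

variable (R) in
theorem cls_restrict_finset (Z : FinActSet M) {I : Type*} [DecidableEq I] (q : Z.carrier → I)
    (hq : ∀ (m : M) z, q (m • z) = q z) (s : Finset I) :
    cls R (Z.restrict q hq (· ∈ s)) = ∑ i ∈ s, cls R (Z.restrict q hq (· = i)) := by
  induction s using Finset.induction_on with
  | empty =>
    have : IsEmpty (Z.restrict q hq (· ∈ (∅ : Finset I))).carrier :=
      ⟨fun z => by simpa using z.2⟩
    rw [cls_of_isEmpty, Finset.sum_empty]
  | insert i s hi ih =>
    rw [Finset.sum_insert hi, ← ih, ← cls_sum]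
    symm
    refine cls_congr R (X := (Z.restrict q hq (· = i)).sum (Z.restrict q hq (· ∈ s)))
      (Y := Z.restrict q hq (· ∈ insert i s))
      (Equiv.ofBijective (Sum.elim (fun z => ⟨z.1, Finset.mem_insert.2 (Or.inl z.2)⟩)
          (fun z => ⟨z.1, Finset.mem_insert.2 (Or.inr z.2)⟩)) ⟨?_, ?_⟩) ?_
    · rintro (⟨z, hz⟩ | ⟨z, hz⟩) (⟨z', hz'⟩ | ⟨z', hz'⟩) h
      all_goals
        obtain rfl : z = z' := congrArg Subtype.val h
      · rfl
      · exact absurd (hz ▸ hz') hi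
      · exact absurd (hz' ▸ hz) hi
      · rfl
    · rintro ⟨z, hz⟩
      rcases Finset.mem_insert.1 hz with h | h
      · exact ⟨Sum.inl ⟨z, h⟩, rfl⟩
      · exact ⟨Sum.inr ⟨z, h⟩, rfl⟩
    · rintro m (z | z) <;> rfl

/-- Decomposition of a finite `M`-set into orbits, with weights on the points that add up to `1` on
each orbit. -/
theorem cls_eq_sum_stabilizer [Finite M] (Z : FinActSet M) [Fintype Z.carrier] (w : Z.carrier → R)
    (hw : open Classical in ∀ z, ∑ z' with z' ∈ MulAction.orbit M z, w z' = 1) :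
    cls R Z = ∑ z, w z • cls R (FinActSet.coset (MulAction.stabilizer M z)) := by
  classical
  let q : Z.carrier → MulAction.orbitRel.Quotient M Z.carrier := Quotient.mk _
  have hq : ∀ (m : M) z, q (m • z) = q z := fun m z =>
    Quotient.sound ⟨m, rfl⟩
  have hqe : ∀ z z', q z' = q z ↔ z' ∈ MulAction.orbit M z := fun z z' =>
    Quotient.eq.trans MulAction.orbitRel_apply
  have : Fintype (MulAction.orbitRel.Quotient M Z.carrier) := Fintype.ofFinite _
  have h1 : cls R Z = ∑ i, cls R (Z.restrict q hq (· = i)) := by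
    rw [← cls_restrict_finset]
    exact cls_congr R (X := Z) (Y := Z.restrict q hq (· ∈ Finset.univ))
      (Equiv.subtypeUnivEquiv fun z => Finset.mem_univ (q z)).symm fun _ _ => rfl
  -- The fibre of `q` through `z` is the orbit of `z`, identified with the cosets of its stabilizer.
  have h2 : ∀ z, cls R (Z.restrict q hq (· = q z))
      = cls R (FinActSet.coset (MulAction.stabilizer M z)) := by
    intro z
    symm
    refine cls_congr R (X := FinActSet.coset (MulAction.stabilizer M z))
      (Y := Z.restrict q hq (· = q z))
      ((MulAction.orbitEquivQuotientStabilizer M z).symm.trans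
        (Equiv.subtypeEquivRight fun z' => (hqe z z').symm)) ?_
    rintro m ⟨n⟩
    exact Subtype.ext (mul_smul m n z)
  rw [h1, ← Finset.sum_fiberwise_of_maps_to (s := Finset.univ) (t := Finset.univ) (g := q)
    (fun _ _ => Finset.mem_univ _)]
  refine Finset.sum_congr rfl fun i _ => ?_
  obtain ⟨z, rfl⟩ : ∃ z, q z = i := Quotient.exists_rep i
  have h3 := hw z
  -- The coefficient `1` of an orbit is spread over its points, so no representatives need be
  -- chosen.
  rw [← one_smul R (cls R (Z.restrict q hq (· = q z))), ← h3, Finset.sum_smul]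
  refine Finset.sum_congr ?_ fun z' hz' => ?_
  · ext z'
    simp only [Finset.mem_filter, Finset.mem_univ, true_and]
    exact (hqe z z').symm
  · rw [← h2 z', (Finset.mem_filter.1 hz').2]

end Orbits

end DoubleBurnside

namespace DoubleBurnside

/-! ### Transitive bisets and their products. -/

section TransitiveBisets

variable {G H K : Type u} [Group G] [Group H] [Group K] (R : Type v) [CommRing R]

/-- The biset `U` is transitive, and `L` is the stabilizer `{(g, h) | g u = u h}` of `u`. -/
structure Biset.IsBase (U : Biset G H) (L : Subgroup (G × H)) (u : U.carrier) : Prop where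
  trans : ∀ x, ∃ g h, x = U.left g (U.right u h)
  mem_iff : ∀ g h, (g, h) ∈ L ↔ U.left g u = U.right u h

theorem Biset.right_eq_iff (U : Biset G H) (x y : U.carrier) (h : H) :
    U.right x h = y ↔ x = U.right y h⁻¹ := by
  constructor
  · rintro rfl
    simp [Biset.right_right]
  · rintro rfl
    simp [Biset.right_right]

/-- The point `(g, h)L` of `(G × H)/L`. -/
def Biset.cosetMk [Finite G] [Finite H] (L : Subgroup (G × H)) (g : G) (h : H) :
    (Biset.coset L).carrier := QuotientGroup.mk (s := L) (g, h)

theorem Biset.cosetMk_eq [Finite G] [Finite H] {L : Subgroup (G × H)} {g g' : G} {h h' : H} :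
    Biset.cosetMk L g h = Biset.cosetMk L g' h' ↔ (g⁻¹ * g', h⁻¹ * h') ∈ L :=
  QuotientGroup.eq

theorem Biset.coset_left [Finite G] [Finite H] (L : Subgroup (G × H)) (a g : G) (h : H) :
    (Biset.coset L).left a (Biset.cosetMk L g h) = Biset.cosetMk L (a * g) h := by
  change Biset.cosetMk L (a * g) (1⁻¹ * h) = _
  rw [inv_one, one_mul]

theorem Biset.coset_right [Finite G] [Finite H] (L : Subgroup (G × H)) (g : G) (b h : H) :
    (Biset.coset L).right (Biset.cosetMk L g h) b = Biset.cosetMk L g (b⁻¹ * h) := by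
  change Biset.cosetMk L (1 * g) (b⁻¹ * h) = _
  rw [one_mul]

theorem Biset.isBase_coset [Finite G] [Finite H] (L : Subgroup (G × H)) :
    (Biset.coset L).IsBase L (Biset.cosetMk L 1 1) where
  trans := by
    rintro ⟨g, h⟩
    refine ⟨g, h⁻¹, ?_⟩
    rw [Biset.coset_right, Biset.coset_left, mul_one, inv_inv, mul_one]
    rfl
  mem_iff g h := by
    rw [Biset.coset_left, Biset.coset_right, eq_comm, Biset.cosetMk_eq]
    simp

theorem Biset.IsBase.eq_iff {U : Biset G H} {L : Subgroup (G × H)} {u : U.carrier}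
    (hu : U.IsBase L u) (a c : G) (b d : H) :
    U.left a (U.right u b⁻¹) = U.left c (U.right u d⁻¹) ↔ (a, b)⁻¹ * (c, d) ∈ L := by
  change _ ↔ (a⁻¹ * c, b⁻¹ * d) ∈ L
  rw [hu.mem_iff, ← Biset.left_left, ← Biset.right_right, Biset.left_right, Biset.left_right]
  constructor
  · intro h
    have h' := congrArg (fun x => U.left a⁻¹ (U.right x d)) h
    simp only [Biset.left_right, Biset.right_right, Biset.left_left, inv_mul_cancel,
      Biset.left_one, Biset.right_one] at h' ⊢
    exact h'.symm
  · intro h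
    have h' := congrArg (fun x => U.left a (U.right x d⁻¹)) h
    simp only [Biset.left_right, Biset.right_right, Biset.left_left, mul_inv_cancel_left,
      mul_inv_cancel_right] at h' ⊢
    exact h'.symm

/-- Orbit-stabilizer: the isomorphism is `(g, h)L ↦ g u h⁻¹`, inverted in `h` because `b` acts on
cosets through `b⁻¹`. -/
theorem Biset.IsBase.cls_eq [Finite G] [Finite H] {U : Biset G H} {L : Subgroup (G × H)}
    {u : U.carrier} (hu : U.IsBase L u) : cls R U = cls R (Biset.coset L) := by
  symm
  refine cls_congr R (X := Biset.coset L) (Y := U) (Equiv.ofBijective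
    (Quotient.lift (s := QuotientGroup.leftRel L)
      (fun p : G × H => U.left p.1 (U.right u p.2⁻¹)) ?_) ⟨?_, ?_⟩) ?_
  · rintro ⟨a, b⟩ ⟨c, d⟩ h
    exact (hu.eq_iff a c b d).2 (QuotientGroup.leftRel_apply.1 h)
  · rintro ⟨a, b⟩ ⟨c, d⟩ h
    exact Quotient.sound (s := QuotientGroup.leftRel L)
      (QuotientGroup.leftRel_apply.2 ((hu.eq_iff a c b d).1 h))
  · intro x
    obtain ⟨g, h, rfl⟩ := hu.trans x
    exact ⟨QuotientGroup.mk (s := L) (g, h⁻¹),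
      congrArg (fun b => U.left g (U.right u b)) (inv_inv h)⟩
  · rintro m ⟨a, b⟩
    change U.left (m.1 * a) (U.right u (m.2.unop⁻¹ * b)⁻¹) = m • U.left a (U.right u b⁻¹)
    rw [Biset.smul_eq, ← Biset.left_right, Biset.right_right, Biset.left_left, mul_inv_rev, inv_inv]

/-- The product `L * L'` of subgroups, as composition of relations. -/
def relComp (L : Subgroup (G × H)) (L' : Subgroup (H × K)) : Subgroup (G × K) where
  carrier := {x | ∃ h, (x.1, h) ∈ L ∧ (h, x.2) ∈ L'}
  one_mem' := ⟨1, L.one_mem, L'.one_mem⟩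
  mul_mem' := by
    rintro ⟨a, b⟩ ⟨c, d⟩ ⟨h, h1, h2⟩ ⟨k, k1, k2⟩
    exact ⟨h * k, L.mul_mem h1 k1, L'.mul_mem h2 k2⟩
  inv_mem' := by
    rintro ⟨a, b⟩ ⟨h, h1, h2⟩
    exact ⟨h⁻¹, L.inv_mem h1, L'.inv_mem h2⟩

theorem mem_relComp {L : Subgroup (G × H)} {L' : Subgroup (H × K)} {g : G} {k : K} :
    (g, k) ∈ relComp L L' ↔ ∃ h, (g, h) ∈ L ∧ (h, k) ∈ L' := Iff.rfl

theorem mem_p₁ {L : Subgroup (G × H)} {g : G} : g ∈ p₁ L ↔ ∃ h, (g, h) ∈ L := by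
  simp [p₁]

theorem mem_p₂ {L : Subgroup (G × H)} {h : H} : h ∈ p₂ L ↔ ∃ g, (g, h) ∈ L := by
  simp [p₂]

theorem mem_k₁ {L : Subgroup (G × H)} {g : G} : g ∈ k₁ L ↔ (g, 1) ∈ L := by
  simp [k₁]

theorem p₂_diag (N : NormalSubgroup G) : p₂ (diag N) = ⊤ := by
  refine eq_top_iff.2 fun a _ => mem_p₂.2 ⟨a, ?_⟩
  change a * a⁻¹ ∈ N.1
  simp

theorem Biset.left_pair (U : Biset G H) (V : Biset H K) (g : G) (u : U.carrier) (v : V.carrier) :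
    (U.tensor V).left g (U.pair V u v) = U.pair V (U.left g u) v := by
  change U.pair V (U.left g u) (V.right v 1) = _
  rw [Biset.right_one]

theorem Biset.right_pair (U : Biset G H) (V : Biset H K) (k : K) (u : U.carrier) (v : V.carrier) :
    (U.tensor V).right (U.pair V u v) k = U.pair V u (V.right v k) := by
  change U.pair V (U.left 1 u) (V.right v k) = _
  rw [Biset.left_one]

/-- The Mackey formula with a single double coset: full second projection of `L` makes the product
transitive. -/
theorem Biset.IsBase.tensor {U : Biset G H} {V : Biset H K} {L : Subgroup (G × H)}
    {L' : Subgroup (H × K)} {u : U.carrier} {v : V.carrier} (hu : U.IsBase L u)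
    (hv : V.IsBase L' v) (hL : p₂ L = ⊤) :
    (U.tensor V).IsBase (relComp L L') (U.pair V u v) where
  trans x := by
    induction x using Biset.tensor_ind with
    | h x y =>
      obtain ⟨a, b, rfl⟩ := hu.trans x
      obtain ⟨c, d, rfl⟩ := hv.trans y
      -- In `[a u b, c v d]` the middle factor moves to the left: `u (b c) = g u`, giving `[a g u, v
      -- d]`.
      obtain ⟨g, hg⟩ := mem_p₂.1 (hL ▸ Subgroup.mem_top (b * c) : b * c ∈ p₂ L)
      refine ⟨a * g, d, ?_⟩
      rw [Biset.left_right, Biset.pair_swap, Biset.left_left, ← Biset.pair_swap,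
        ← Biset.left_right, ← (hu.mem_iff g (b * c)).1 hg, Biset.left_left, Biset.right_pair,
        Biset.left_pair]
  mem_iff g k := by
    -- With this orientation, the element of `H` relating the two pairs is exactly the middle
    -- element of the composed relation.
    rw [Biset.left_pair, Biset.right_pair, mem_relComp, eq_comm]
    refine Iff.trans ?_ (Quotient.eq (r := tensorSetoid U V)).symm
    refine exists_congr fun h => ?_
    rw [hu.mem_iff, hv.mem_iff]
    refine Iff.trans (and_congr_right' ?_)
      (Prod.ext_iff (x := (U.left g u, v)) (y := (U.right u h, V.left h⁻¹ (V.right v k)))).symm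
    change _ ↔ v = V.left h⁻¹ (V.right v k)
    constructor
    · intro hk
      rw [← hk, Biset.left_left, inv_mul_cancel, Biset.left_one]
    · intro hk
      conv_lhs => rw [hk]
      rw [Biset.left_left, mul_inv_cancel, Biset.left_one]

theorem prod_coset [Finite G] [Finite H] [Finite K] (L : Subgroup (G × H)) (L' : Subgroup (H × K))
    (hL : p₂ L = ⊤) : prod (cls R (Biset.coset L)) (cls R (Biset.coset L'))
      = cls R (Biset.coset (relComp L L')) := by
  rw [prod_cls]
  exact ((Biset.isBase_coset L).tensor (Biset.isBase_coset L') hL).cls_eq R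

/-- `Δ_Q * L = L`, as `(g, h) = (g a⁻¹, 1)(a, h)` with `g a⁻¹ ∈ Q ≤ k₁ L`. This allows a factor
`[Δ_Q]` to be inserted for free. -/
theorem prod_diag_coset_of_le [Finite G] [Finite H] (Q : NormalSubgroup G) (L : Subgroup (G × H))
    (hQ : Q.1 ≤ k₁ L) : prod (cls R (Biset.coset (diag Q))) (cls R (Biset.coset L))
      = cls R (Biset.coset L) := by
  rw [prod_coset]
  · congr 2
    ext ⟨g, h⟩
    rw [mem_relComp]
    constructor
    · rintro ⟨a, ha, hL⟩
      simpa using L.mul_mem (mem_k₁.1 (hQ ha)) hL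
    · intro hL
      refine ⟨g, ?_, hL⟩
      change g * g⁻¹ ∈ Q.1
      simp
  · exact p₂_diag Q

/-- The subgroup `{(k, k) | k ∈ K}`. -/
def diagonal (K : Subgroup G) : Subgroup (G × G) :=
  K.map ((MonoidHom.id G).prod (MonoidHom.id G))

theorem mem_diagonal {K : Subgroup G} {a b : G} : (a, b) ∈ diagonal K ↔ a ∈ K ∧ a = b := by
  simp only [diagonal, Subgroup.mem_map]
  constructor
  · rintro ⟨k, hk, h⟩
    cases h
    exact ⟨hk, rfl⟩
  · rintro ⟨ha, rfl⟩
    exact ⟨a, ha, rfl⟩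

theorem p₁_diagonal (K : Subgroup G) : p₁ (diagonal K) = K := by
  ext a
  simp [mem_p₁, mem_diagonal]

/-- At the base point `(1, K)`, one has `g (1, K) = (g, gK)` and `(1, K) h = (h, K)`; they agree iff
`g = h ∈ K`. -/
theorem tilde_coset [Finite G] (K : Subgroup G) :
    tilde R G (cls R (FinActSet.coset K)) = cls R (Biset.coset (diagonal K)) := by
  rw [tilde_cls]
  refine Biset.IsBase.cls_eq R (U := (FinActSet.coset K).tilde)
    (u := ((1, QuotientGroup.mk (s := K) 1) : G × (G ⧸ K))) ⟨?_, ?_⟩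
  · rintro ⟨a, x⟩
    obtain ⟨x, rfl⟩ := QuotientGroup.mk_surjective (s := K) x
    refine ⟨x, x⁻¹ * a, ?_⟩
    refine Prod.ext ?_ ?_
    · change a = x * (1 * (1 * (x⁻¹ * a)) * 1)
      simp
    · refine Eq.trans ?_ (congrArg (x • ·) (one_smul G (QuotientGroup.mk (s := K) 1))).symm
      change _ = QuotientGroup.mk (s := K) (x * 1)
      rw [mul_one]
  · intro g h
    rw [mem_diagonal]
    have hl : (FinActSet.coset K).tilde.left g ((1, QuotientGroup.mk (s := K) 1) : G × (G ⧸ K))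
        = ((g, QuotientGroup.mk (s := K) g) : G × (G ⧸ K)) := by
      change ((g * (1 * 1), QuotientGroup.mk (s := K) (g * 1)) : G × (G ⧸ K)) = _
      simp
    have hr : (FinActSet.coset K).tilde.right ((1, QuotientGroup.mk (s := K) 1) : G × (G ⧸ K)) h
        = ((h, QuotientGroup.mk (s := K) 1) : G × (G ⧸ K)) := by
      change ((1 * (1 * h), QuotientGroup.mk (s := K) (1 * 1)) : G × (G ⧸ K)) = _
      simp
    rw [hl, hr]
    refine Iff.trans ?_ Prod.ext_iff.symm
    rw [and_comm]
    refine and_congr Iff.rfl ?_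
    rw [eq_comm (a := QuotientGroup.mk (s := K) g)]
    refine Iff.trans ?_ QuotientGroup.eq.symm
    simp

end TransitiveBisets

end DoubleBurnside

namespace DoubleBurnside

/-! ### Vanishing of `e` on transitive bisets with proper first projection. -/

section Vanishing

instance (H : Type*) [Finite H] : Finite Hᵐᵒᵖ := Finite.of_equiv H MulOpposite.opEquiv

variable {G H : Type u} [Group G] [Group H] (R : Type v) [CommRing R]

/-- The biset `X × U`, for a `G`-set `X` and a `(G, H)`-biset `U`, with `a (x, u) b = (a x, a u b)`.
-/
def FinActSet.twist (X : FinActSet G) (U : Biset G H) : Biset G H where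
  carrier := X.carrier × U.carrier
  action :=
    { smul := fun m p => (m.1 • p.1, m • p.2)
      one_smul := fun p => Prod.ext (one_smul G p.1) (one_smul (G × Hᵐᵒᵖ) p.2)
      mul_smul := fun m n p => Prod.ext (mul_smul m.1 n.1 p.1) (mul_smul m n p.2) }

theorem FinActSet.smul_twist (X : FinActSet G) (U : Biset G H) (m : G × Hᵐᵒᵖ) (x : X.carrier)
    (u : U.carrier) :
    m • (show (X.twist U).carrier from (x, u)) = (show (X.twist U).carrier from (m.1 • x, m • u)) :=
  rfl

/-- The right action of `G` on the tilde biset only translates the coordinate in `G`, so every class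
has a unique representative `[(1, x), u]`; in general `[(g, x), u]` corresponds to `(x, g u)`. -/
theorem prod_tilde [Finite G] (X : FinActSet G) (U : Biset G H) :
    prod (cls R X.tilde) (cls R U) = cls R (X.twist U) := by
  rw [prod_cls]
  refine cls_congr R (X := X.tilde.tensor U) (Y := X.twist U)
    { toFun := Biset.tensorLift (fun (p : G × X.carrier) u => (p.2, U.left p.1 u)) ?_
      invFun := fun p => X.tilde.pair U ((1, p.1) : G × X.carrier) p.2
      left_inv := ?_
      right_inv := fun p => Prod.ext rfl (U.left_one p.2) } ?_
  · rintro ⟨g, x⟩ h u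
    change ((1 : G) • x, U.left (1 * (g * h)) u) = (x, U.left g (U.left h u))
    rw [one_smul, one_mul, Biset.left_left]
  · intro y
    induction y using Biset.tensor_ind with
    | h p u =>
      obtain ⟨g, x⟩ := p
      refine (X.tilde.pair_swap U ((1, x) : G × X.carrier) g u).symm.trans ?_
      congr 1
      change ((1 * (1 * g), (1 : G) • x) : G × X.carrier) = (g, x)
      rw [one_smul, one_mul, one_mul]
  · intro m y
    induction y using Biset.tensor_ind with
    | h p u =>
      obtain ⟨g, x⟩ := p
      change (m.1 • x, U.left (m.1 * (g * 1)) (U.right u m.2.unop)) = (m.1 • x, m • U.left g u)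
      rw [Biset.smul_eq, mul_one, ← Biset.left_left, Biset.left_right U g]

/-- Each point of the orbit has a stabilizer of order `|P| / |orbit|`. So `|P_x| / |P|` are weights
of total `1` on every orbit. -/
theorem sum_card_stabilizer_orbit {P X : Type*} [Group P] [Finite P] [MulAction P X] [Fintype X]
    (x : X) : open Classical in
    ∑ x' with x' ∈ MulAction.orbit P x, Nat.card (MulAction.stabilizer P x') = Nat.card P := by
  classical
  have : Fintype P := Fintype.ofFinite P
  have hc : ∀ x' ∈ MulAction.orbit P x,
      Nat.card (MulAction.orbit P x) * Nat.card (MulAction.stabilizer P x') = Nat.card P := by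
    intro x' hx'
    rw [← MulAction.orbit_eq_iff.2 hx']
    simpa using MulAction.card_orbit_mul_card_stabilizer_eq_card_group P x'
  have hpos : 0 < Nat.card (MulAction.orbit P x) := by
    have : Nonempty (MulAction.orbit P x) := ⟨⟨x, MulAction.mem_orbit_self x⟩⟩
    exact Nat.card_pos
  refine Nat.eq_of_mul_eq_mul_left hpos ?_
  rw [Finset.mul_sum, Finset.sum_congr rfl fun x' hx' => hc x' (Finset.mem_filter.1 hx').2,
    Finset.sum_const, smul_eq_mul]
  congr 1
  rw [← Fintype.card_subtype, Nat.card_eq_fintype_card]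

theorem isUnit_card_subgroup {R : Type v} [CommRing R] (hG : IsUnit (Nat.card G : R))
    (K : Subgroup G) : IsUnit (Nat.card K : R) :=
  isUnit_of_dvd_unit (Nat.cast_dvd_cast K.card_subgroup_dvd_card) hG

theorem stabilizer_mk (K : Subgroup G) (g : G) :
    MulAction.stabilizer G (QuotientGroup.mk (s := K) g) = K.map (MulAut.conj g).toMonoidHom := by
  ext a
  rw [MulAction.mem_stabilizer_iff, Subgroup.mem_map, eq_comm]
  refine (QuotientGroup.eq (a := g) (b := a * g)).trans ⟨fun h => ⟨_, h, ?_⟩, ?_⟩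
  · simp
  · rintro ⟨k, hk, rfl⟩
    simpa using hk

theorem map_inf_comap {N : Type*} [Group N] (f : G →* N) (K : Subgroup G) (A : Subgroup N) :
    (K ⊓ A.comap f).map f = K.map f ⊓ A := by
  ext n
  simp only [Subgroup.mem_map, Subgroup.mem_inf, Subgroup.mem_comap]
  constructor
  · rintro ⟨k, ⟨hk, hA⟩, rfl⟩
    exact ⟨⟨k, hk, rfl⟩, hA⟩
  · rintro ⟨⟨k, hk, rfl⟩, hA⟩
    exact ⟨k, ⟨hk, hA⟩, rfl⟩

variable [Finite G] [Finite H]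

/-- The summand attached to a point with stabilizer `K` in the decomposition of the biset
`X × (G × H)/L`. -/
noncomputable def orbitTerm (L : Subgroup (G × H)) (K : Subgroup G) : RB R G H :=
  (Ring.inverse (Nat.card (p₁ L) : R) * (Nat.card (K.subgroupOf (p₁ L)) : R)) •
    cls R (FinActSet.coset (MulAction.stabilizer (G × Hᵐᵒᵖ) (Biset.cosetMk L 1 1) ⊓
      K.comap (MonoidHom.fst G Hᵐᵒᵖ)))

theorem mem_stabilizer_cosetMk {L : Subgroup (G × H)} {m : G × Hᵐᵒᵖ} :
    m ∈ MulAction.stabilizer (G × Hᵐᵒᵖ) (Biset.cosetMk L 1 1) ↔ (m.1, m.2.unop⁻¹) ∈ L := by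
  rw [MulAction.mem_stabilizer_iff, Biset.smul_eq, Biset.coset_right, Biset.coset_left, eq_comm,
    Biset.cosetMk_eq]
  simp

/-- Stabilizing the base coset already forces the first coordinate into `p₁ L`. Dependence on `K ⊓
p₁ L` alone is what Weisner's theorem needs. -/
theorem orbitTerm_inf (L : Subgroup (G × H)) (K : Subgroup G) :
    orbitTerm R L (K ⊓ p₁ L) = orbitTerm R L K := by
  unfold orbitTerm
  congr 2
  · rw [Subgroup.inf_subgroupOf_right]
  · congr 1
    ext m
    simp only [Subgroup.mem_inf, mem_stabilizer_cosetMk, Subgroup.mem_comap, mem_p₁]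
    exact ⟨fun h => ⟨h.1, h.2.1⟩, fun h => ⟨h.1, h.2, _, h.1⟩⟩

/-- Every orbit on `X × (G × H)/L` meets the fibre over the base coset, in exactly one `p₁ L`-orbit
of `X`. The weights are therefore supported on that fibre, with the value `|P_x| / |P|` for `P = p₁
L`. -/
theorem prod_tilde_coset (X : FinActSet G) [Fintype X.carrier] (L : Subgroup (G × H))
    (hL : IsUnit (Nat.card (p₁ L) : R)) :
    prod (cls R X.tilde) (cls R (Biset.coset L))
      = ∑ x : X.carrier, orbitTerm R L (MulAction.stabilizer G x) := by
  classical
  have : Fintype (Biset.coset L).carrier := Fintype.ofFinite _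
  let _ : Fintype (X.twist (Biset.coset L)).carrier :=
    inferInstanceAs (Fintype (X.carrier × (Biset.coset L).carrier))
  let w : X.carrier × (Biset.coset L).carrier → R := fun p =>
    if p.2 = Biset.cosetMk L 1 1 then Ring.inverse (Nat.card (p₁ L) : R) *
      (Nat.card ((MulAction.stabilizer G p.1).subgroupOf (p₁ L)) : R) else 0
  rw [prod_tilde, cls_eq_sum_stabilizer (X.twist (Biset.coset L)) w]
  · refine (Fintype.sum_prod_type (α₁ := X.carrier) (α₂ := (Biset.coset L).carrier) _).trans ?_
    refine Finset.sum_congr rfl fun x _ => ?_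
    rw [Finset.sum_eq_single_of_mem (Biset.cosetMk L 1 1) (Finset.mem_univ _)]
    · simp only [w, if_true]
      unfold orbitTerm
      congr 3
      ext m
      rw [Subgroup.mem_inf, and_comm]
      exact Prod.ext_iff
    · intro u _ hu
      simp only [w, if_neg hu, zero_smul]
  · rintro ⟨x, u⟩
    obtain ⟨g, h, rfl⟩ := (Biset.isBase_coset L).trans u
    -- The point is first moved within its orbit to `(g⁻¹ x, L)`, over the base coset.
    have hz : ∀ x' u', (show (X.twist (Biset.coset L)).carrier from (x', u')) ∈
        MulAction.orbit (G × Hᵐᵒᵖ) (show (X.twist (Biset.coset L)).carrier from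
          (x, (Biset.coset L).left g ((Biset.coset L).right (Biset.cosetMk L 1 1) h))) ↔
        ∃ m : G × Hᵐᵒᵖ, m.1 • g⁻¹ • x = x' ∧ m • Biset.cosetMk L 1 1 = u' := by
      intro x' u'
      have h0 : (show (X.twist (Biset.coset L)).carrier from
          (x, (Biset.coset L).left g ((Biset.coset L).right (Biset.cosetMk L 1 1) h)))
          = ((g, MulOpposite.op h) : G × Hᵐᵒᵖ) • (show (X.twist (Biset.coset L)).carrier from
            (g⁻¹ • x, Biset.cosetMk L 1 1)) := by
        rw [FinActSet.smul_twist, smul_inv_smul, Biset.smul_eq]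
        rfl
      rw [h0, MulAction.orbit_smul]
      exact exists_congr fun m => Prod.ext_iff
    rw [Finset.sum_filter]
    refine (Fintype.sum_prod_type (α₁ := X.carrier) (α₂ := (Biset.coset L).carrier) _).trans ?_
    have h1 := sum_card_stabilizer_orbit (P := p₁ L) (g⁻¹ • x)
    refine Eq.trans ?_ ((congrArg
      (fun t : ℕ => Ring.inverse (Nat.card (p₁ L) : R) * (t : R)) h1).trans (Ring.inverse_mul_cancel _ hL))
    rw [Nat.cast_sum, Finset.mul_sum, Finset.sum_filter]
    refine Finset.sum_congr rfl fun x' _ => ?_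
    rw [Finset.sum_eq_single_of_mem (Biset.cosetMk L 1 1) (Finset.mem_univ _)]
    · simp only [if_true]
      refine if_congr ?_ ?_ rfl
      · rw [hz]
        constructor
        · rintro ⟨m, rfl, hm⟩
          exact ⟨⟨m.1, mem_p₁.2 ⟨_, mem_stabilizer_cosetMk.1 hm⟩⟩, rfl⟩
        · rintro ⟨⟨a, ha⟩, rfl⟩
          obtain ⟨b, hb⟩ := mem_p₁.1 ha
          exact ⟨(a, MulOpposite.op b⁻¹), rfl, mem_stabilizer_cosetMk.2 (by simpa using hb)⟩
      · rfl
    · intro u _ hu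
      simp only [if_neg hu, ite_self]

/-- The factor `|K|` in the coefficients of `e` turns a sum over `G/K` into one over `G`, an index
set independent of `K`; the sums over `K` and `g` can then be exchanged. -/
theorem card_smul_sum_quotient (K : Subgroup G) [Fintype G] [Fintype (G ⧸ K)] {A : Type*}
    [AddCommGroup A] (f : G ⧸ K → A) :
    Nat.card K • ∑ x, f x = ∑ g : G, f (QuotientGroup.mk g) := by
  classical
  have : Fintype K := Fintype.ofFinite K
  rw [← Equiv.sum_comp (Subgroup.groupEquivQuotientProdSubgroup (s := K)).symm,
    Fintype.sum_prod_type, Finset.smul_sum]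
  refine Finset.sum_congr rfl fun x _ => ?_
  rw [Nat.card_eq_fintype_card, ← Finset.card_univ, ← Finset.sum_const]
  refine Finset.sum_congr rfl fun k _ => ?_
  exact congrArg f (congrArg Prod.fst
    ((Subgroup.groupEquivQuotientProdSubgroup (s := K)).apply_symm_apply (x, k))).symm

/-- For each fixed `g`, the term of `K` depends only on `gKg⁻¹ ∩ p₁ L`, that is, on `K ∩ g⁻¹ (p₁ L)
g`. The second subgroup is proper, so Weisner's theorem kills the sum over `K`. -/
theorem eTilde_prod_coset_eq_zero (hG : IsUnit (Nat.card G : R)) (L : Subgroup (G × H))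
    (hL : p₁ L ≠ ⊤) : prod (eTilde R G) (cls R (Biset.coset L)) = 0 := by
  classical
  have : Fintype G := Fintype.ofFinite G
  have : Fintype (Subgroup G) := Fintype.ofFinite _
  have hterm : ∀ K : Subgroup G, ((Nat.card K : R) * (moebius K ⊤ : R)) •
      prod (tilde R G (cls R (FinActSet.coset K))) (cls R (Biset.coset L))
      = ∑ g : G, moebius K ⊤ • orbitTerm R L (K.map (MulAut.conj g).toMonoidHom) := by
    intro K
    have : Fintype (FinActSet.coset K).carrier := Fintype.ofFinite _
    have : Fintype (G ⧸ K) := Fintype.ofFinite _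
    rw [tilde_cls, prod_tilde_coset R _ L (isUnit_card_subgroup hG _), mul_comm, mul_smul]
    have h1 := card_smul_sum_quotient K
      (fun x => orbitTerm R L (MulAction.stabilizer G x))
    rw [← Finset.smul_sum, Nat.cast_smul_eq_nsmul, Int.cast_smul_eq_zsmul]
    congr 1
    refine Eq.trans ?_ (h1.trans ?_)
    · congr!
    · exact Finset.sum_congr rfl fun g _ => by rw [stabilizer_mk]
  have hmain : ∑ K : Subgroup G, ((Nat.card K : R) * (moebius K ⊤ : R)) •
      prod (tilde R G (cls R (FinActSet.coset K))) (cls R (Biset.coset L)) = 0 := by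
    rw [Finset.sum_congr rfl fun K _ => hterm K, Finset.sum_comm]
    refine Finset.sum_eq_zero fun g _ => ?_
    have hg : (p₁ L).comap (MulAut.conj g).toMonoidHom ≠ ⊤ := fun h =>
      hL (Subgroup.comap_injective (f := (MulAut.conj g).toMonoidHom)
        (MulAut.conj g).surjective (h.trans (Subgroup.comap_top _).symm))
    refine Eq.trans ?_ (sum_moebius_top_smul_inf hg
      (fun K => orbitTerm R L (K.map (MulAut.conj g).toMonoidHom)))
    refine Finset.sum_congr rfl fun K _ => ?_
    rw [map_inf_comap, orbitTerm_inf]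
  have hsum : ∑ K : {K : Subgroup G // K ≤ ⊤}, ((Nat.card K.1 : R) * (moebius K.1 ⊤ : R)) •
      prod (tilde R G (cls R (FinActSet.coset K.1))) (cls R (Biset.coset L)) = 0 := by
    rw [← hmain]
    exact Fintype.sum_equiv (Equiv.subtypeUnivEquiv fun _ => le_top) _ _ fun _ => rfl
  let pr : RB R G G →ₗ[R] RB R G H :=
    (bilinearize R (tensorHom G G H)).flip (cls R (Biset.coset L))
  change pr (eTilde R G) = 0
  unfold eTilde burnsideIdempotent
  rw [map_smul, map_smul, map_sum, map_sum]
  simp only [map_smul]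
  exact (congrArg _ hsum).trans (smul_zero _)

end Vanishing

end DoubleBurnside

namespace DoubleBurnside

/-! ### Opposite bisets, exchanging left and right. -/

section Opposite

variable {G H K : Type u} [Group G] [Group H] [Group K] (R : Type v) [CommRing R]

/-- The opposite biset, with `h u g = g⁻¹ u h⁻¹`. -/
def Biset.opposite (U : Biset G H) : Biset H G :=
  Biset.ofActions U.carrier (fun h u => U.right u h⁻¹) (fun u g => U.left g⁻¹ u)
    (by simp) (by simp [Biset.right_right]) (by simp) (by simp [Biset.left_left])
    (by simp [Biset.left_right])

theorem Biset.opposite_left (U : Biset G H) (h : H) (u : U.carrier) :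
    (Biset.opposite U).left h u = U.right u h⁻¹ := by
  change U.right (U.left 1⁻¹ u) h⁻¹ = _
  simp

theorem Biset.opposite_right (U : Biset G H) (g : G) (u : U.carrier) :
    (Biset.opposite U).right u g = U.left g⁻¹ u := by
  change U.right (U.left g⁻¹ u) 1⁻¹ = _
  simp

/-- The additive map `[U] ↦ [Uᵒᵖ]` on isomorphism classes of bisets. -/
def oppositeHom (G H : Type u) [Group G] [Group H] :
    IsoClass (G × Hᵐᵒᵖ) →+ IsoClass (H × Gᵐᵒᵖ) where
  toFun := Quotient.map (sa := isoSetoid _) (sb := isoSetoid _) Biset.opposite (by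
    rintro X Y ⟨e, he⟩
    refine ⟨e, fun m x => ?_⟩
    change e (((1, MulOpposite.op m.1⁻¹) : G × Hᵐᵒᵖ) • ((m.2.unop⁻¹, 1) : G × Hᵐᵒᵖ) •
      (show X.carrier from x)) = _
    rw [he, he]
    rfl)
  map_zero' := by
    refine IsoClass.sound (X := Biset.opposite FinActSet.empty) (Y := FinActSet.empty)
      (Equiv.refl _) ?_
    intro m x
    exact x.elim
  map_add' := by
    rintro ⟨X⟩ ⟨Y⟩
    refine IsoClass.sound (X := Biset.opposite (X.sum Y))
      (Y := FinActSet.sum (Biset.opposite X) (Biset.opposite Y)) (Equiv.refl _) ?_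
    rintro m (x | x) <;> rfl

/-- The `R`-linear map `RB(G, H) → RB(H, G)`, `[U] ↦ [Uᵒᵖ]`. -/
noncomputable def opposite : RB R G H →ₗ[R] RB R H G := linearize R (oppositeHom G H)

theorem opposite_cls (U : Biset G H) : opposite R (cls R U) = cls R (Biset.opposite U) :=
  linearize_cls R _ _ _ rfl

theorem opposite_opposite (a : RB R G H) : opposite R (opposite R a) = a := by
  induction a using RBurnside.induction with
  | hadd a a' h h' => rw [map_add, map_add, h, h']
  | hsmul r a h => rw [map_smul, map_smul, h]
  | hcls U =>
    rw [opposite_cls, opposite_cls]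
    refine cls_congr R (X := Biset.opposite (Biset.opposite U)) (Y := U) (Equiv.refl _) ?_
    intro m u
    refine (Biset.smul_eq (Biset.opposite (Biset.opposite U)) m u).trans ?_
    refine Eq.trans ?_ (Biset.smul_eq U m u).symm
    refine (Biset.opposite_left (Biset.opposite U) _ _).trans ?_
    refine (Biset.opposite_right U _ _).trans (congrArg₂ (Biset.left U) (inv_inv _) ?_)
    refine (Biset.opposite_right (Biset.opposite U) _ _).trans ?_
    exact (Biset.opposite_left U _ _).trans (congrArg (Biset.right U u) (inv_inv _))

/-- The isomorphism is `[u, v] ↦ [v, u]`. It transports statements about left factors to right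
factors. -/
theorem opposite_prod (a : RB R G H) (b : RB R H K) :
    opposite R (prod a b) = prod (opposite R b) (opposite R a) := by
  induction a using RBurnside.induction with
  | hadd a a' h h' => simp only [add_prod, prod_add, map_add, h, h']
  | hsmul r a h => simp only [smul_prod, prod_smul, map_smul, h]
  | hcls U =>
    induction b using RBurnside.induction with
    | hadd a a' h h' => simp only [add_prod, prod_add, map_add, h, h']
    | hsmul r a h => simp only [smul_prod, prod_smul, map_smul, h]
    | hcls V =>
      rw [prod_cls, opposite_cls, opposite_cls, opposite_cls, prod_cls]
      have hf : ∀ (u : U.carrier) (h : H) (v : V.carrier),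
          (Biset.opposite V).pair (Biset.opposite U) v (Biset.right U u h)
            = (Biset.opposite V).pair (Biset.opposite U) (Biset.left V h v) u := by
        intro u h v
        have h1 := (Biset.opposite V).pair_swap (Biset.opposite U) v h⁻¹ u
        rw [Biset.opposite_left, Biset.opposite_right, inv_inv] at h1
        exact h1.symm
      refine cls_congr R (X := Biset.opposite (Biset.tensor U V))
        (Y := Biset.tensor (Biset.opposite V) (Biset.opposite U))
        { toFun := Biset.tensorLift (fun u v => (Biset.opposite V).pair (Biset.opposite U) v u) hf
          invFun := Biset.tensorLift (fun v u => Biset.pair U V u v) ?_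
          left_inv := ?_
          right_inv := ?_ } ?_
      · intro v h u
        refine (congrArg (Biset.pair U V u) (Biset.opposite_right V h v)).trans ?_
        refine Eq.trans ?_ (congrArg (Biset.pair U V · v) (Biset.opposite_left U h u)).symm
        exact (Biset.pair_swap U V u h⁻¹ v).symm
      · intro x
        induction x using Biset.tensor_ind with
        | h u v => rfl
      · intro x
        induction x using Biset.tensor_ind with
        | h v u => rfl
      · intro m x
        induction x using Biset.tensor_ind with
        | h u v =>
          have h0 : m • (show (Biset.opposite (Biset.tensor U V)).carrier from Biset.pair U V u v)
              = Biset.pair U V (Biset.left U m.2.unop⁻¹ u) (Biset.right V v m.1⁻¹) := by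
            refine (Biset.smul_eq (Biset.opposite (Biset.tensor U V)) m _).trans ?_
            refine (Biset.opposite_left (Biset.tensor U V) _ _).trans ?_
            refine Eq.trans ?_ (Biset.right_pair U V _ _ _)
            refine congrArg (fun x => Biset.right (Biset.tensor U V) x _) ?_
            exact (Biset.opposite_right (Biset.tensor U V) _ _).trans (Biset.left_pair U V _ _ _)
          refine (congrArg (Biset.tensorLift (U := U) (V := V)
            (fun u v => (Biset.opposite V).pair (Biset.opposite U) v u) hf) h0).trans ?_
          change (Biset.opposite V).pair (Biset.opposite U) (Biset.right V v m.1⁻¹)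
              (Biset.left U m.2.unop⁻¹ u) = (Biset.opposite V).pair (Biset.opposite U)
              ((Biset.opposite V).left m.1 v) ((Biset.opposite U).right u m.2.unop)
          rw [Biset.opposite_left, Biset.opposite_right]

/-- The opposite `{(h, g) | (g, h) ∈ L}` of a subgroup `L ≤ G × H`. -/
def swap (L : Subgroup (G × H)) : Subgroup (H × G) :=
  L.comap (MulEquiv.prodComm : H × G ≃* G × H).toMonoidHom

theorem mem_swap {L : Subgroup (G × H)} {g : G} {h : H} : (h, g) ∈ swap L ↔ (g, h) ∈ L := Iff.rfl

theorem p₁_swap (L : Subgroup (G × H)) : p₁ (swap L) = p₂ L := by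
  ext h
  simp only [mem_p₁, mem_p₂, mem_swap]

theorem k₁_swap (L : Subgroup (G × H)) : k₁ (swap L) = k₂ L := rfl

theorem Biset.IsBase.opposite {U : Biset G H} {L : Subgroup (G × H)} {u : U.carrier}
    (hu : U.IsBase L u) : (Biset.opposite U).IsBase (swap L) u where
  trans x := by
    obtain ⟨g, h, hx⟩ := hu.trans x
    refine ⟨h⁻¹, g⁻¹, hx.trans ?_⟩
    refine Eq.trans ?_ (Biset.opposite_left U _ _).symm
    refine Eq.trans ?_ (congrArg (fun y => U.right y _) (Biset.opposite_right U _ _).symm)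
    rw [inv_inv, inv_inv, Biset.left_right]
  mem_iff h g := by
    rw [mem_swap, hu.mem_iff]
    refine Iff.trans ?_ (Eq.congr (Biset.opposite_left U h u) (Biset.opposite_right U g u)).symm
    change _ ↔ U.right u h⁻¹ = U.left g⁻¹ u
    rw [Biset.right_eq_iff, inv_inv, ← Biset.left_right]
    constructor
    · intro h1
      rw [← h1, Biset.left_left, inv_mul_cancel, Biset.left_one]
    · intro h1
      conv_lhs => rw [h1]
      rw [Biset.left_left, mul_inv_cancel, Biset.left_one]

theorem opposite_coset [Finite G] [Finite H] (L : Subgroup (G × H)) :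
    opposite R (cls R (Biset.coset L)) = cls R (Biset.coset (swap L)) := by
  rw [opposite_cls]
  exact (Biset.isBase_coset L).opposite.cls_eq R

theorem swap_diagonal (K : Subgroup G) : swap (diagonal K) = diagonal K := by
  ext ⟨a, b⟩
  rw [mem_swap, mem_diagonal, mem_diagonal]
  constructor <;> rintro ⟨h, rfl⟩ <;> exact ⟨h, rfl⟩

theorem swap_diag (N : NormalSubgroup G) : swap (diag N) = diag N := by
  ext ⟨a, b⟩
  change b * a⁻¹ ∈ N.1 ↔ a * b⁻¹ ∈ N.1
  rw [← N.1.inv_mem_iff]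
  simp

/-- `e` is a combination of classes of diagonal subgroups, each its own swap. -/
theorem opposite_eTilde [Finite G] : opposite R (eTilde R G) = eTilde R G := by
  unfold eTilde burnsideIdempotent
  simp only [map_smul, map_sum, tilde_coset, opposite_coset, swap_diagonal]

end Opposite

/-! ### Joins of normal subgroups and composition of the `Δ_N`. -/

section NormalSup

variable {G : Type u} [Group G]

/-- The join of two normal subgroups. -/
def normalSup (M N : NormalSubgroup G) : NormalSubgroup G :=
  ⟨M.1 ⊔ N.1, haveI := M.2; haveI := N.2; inferInstance⟩

theorem normalSup_le_iff (M N T : NormalSubgroup G) : normalSup M N ≤ T ↔ M ≤ T ∧ N ≤ T :=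
  sup_le_iff (a := M.1)

theorem normalSup_eq_left {M N : NormalSubgroup G} (h : N ≤ M) : normalSup M N = M :=
  Subtype.ext (sup_eq_left.2 h)

theorem relComp_diag (M N : NormalSubgroup G) :
    relComp (diag M) (diag N) = diag (normalSup M N) := by
  ext ⟨a, b⟩
  have := N.2
  rw [mem_relComp]
  change (∃ h, a * h⁻¹ ∈ M.1 ∧ h * b⁻¹ ∈ N.1) ↔ a * b⁻¹ ∈ M.1 ⊔ N.1
  rw [Subgroup.mem_sup_of_normal_right]
  constructor
  · rintro ⟨h, h1, h2⟩
    exact ⟨_, h1, _, h2, by group⟩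
  · rintro ⟨x, hx, y, hy, h⟩
    -- From `a b⁻¹ = x y`, the middle element `y b` gives `a (y b)⁻¹ = x` and `(y b) b⁻¹ = y`.
    refine ⟨y * b, ?_, by simpa using hy⟩
    rw [← eq_mul_inv_iff_mul_eq] at h
    rw [mul_inv_rev, ← mul_assoc, ← h]
    exact hx

end NormalSup

/-! ### Idempotence of `e` and multiplication of the `Y_{Δ_N}`. -/

section Absorption

variable {G : Type u} [Group G] [Finite G] {R : Type v} [CommRing R]

theorem moebius_self {P : Type*} [PartialOrder P] [Finite P] (x : P) : moebius x x = 1 := by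
  simp [moebius]

theorem coset_diagonal_top : cls R (Biset.coset (diagonal (⊤ : Subgroup G))) = 1 := by
  symm
  refine Biset.IsBase.cls_eq R (U := Biset.id G) (u := (1 : G)) ⟨?_, ?_⟩
  · intro (g : G)
    refine ⟨g, 1, ?_⟩
    change g = g * (1 * ((1 : G) * 1) * 1)
    simp
  · intro g h
    rw [mem_diagonal]
    change _ ↔ g * ((1 : G) * 1) = 1 * ((1 : G) * h)
    simp

/-- In `e`, the summand `K = G` has coefficient `|G| μ(G, G) / |N_G(G)| = 1` and class `1`; all
others are multiples of diagonals of proper subgroups. -/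
theorem mul_eTilde_eq_self (hG : IsUnit (Nat.card G : R)) (a : RB R G G)
    (ha : ∀ K : Subgroup G, K ≠ ⊤ → a * cls R (Biset.coset (diagonal K)) = 0) :
    a * eTilde R G = a := by
  classical
  unfold eTilde burnsideIdempotent
  simp only [map_smul, map_sum, tilde_coset]
  rw [mul_smul_comm, Finset.mul_sum,
    Finset.sum_eq_single_of_mem (⟨⊤, le_rfl⟩ : {K : Subgroup G // K ≤ ⊤}) (Finset.mem_univ _)]
  · rw [coset_diagonal_top, moebius_self, Int.cast_one, mul_one, mul_smul_comm, mul_one, smul_smul]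
    have h1 : Subgroup.normalizer ((⊤ : Subgroup G) : Set G) = ⊤ :=
      Subgroup.normalizer_eq_top_iff.2 inferInstance
    rw [h1, Subgroup.card_top, Ring.inverse_mul_cancel _ hG, one_smul]
  · intro K _ hK
    rw [mul_smul_comm, ha K.1 fun h => hK (Subtype.ext h), smul_zero]

theorem eTilde_mul_self (hG : IsUnit (Nat.card G : R)) : eTilde R G * eTilde R G = eTilde R G :=
  mul_eTilde_eq_self hG _ fun K hK =>
    eTilde_prod_coset_eq_zero R hG _ (by rwa [p₁_diagonal])

/-- The first projection of `Δ_N * diagonal K` lies in `KN ≤ K Φ(G)`, which is proper for `K < G`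
because the Frattini subgroup consists of non-generators. Hence `e` kills these composites. -/
theorem eTilde_mul_diag_mul_eTilde (hG : IsUnit (Nat.card G : R)) {N : NormalSubgroup G}
    (hN : N.1 ≤ frattini G) : eTilde R G * cls R (Biset.coset (diag N)) * eTilde R G
      = eTilde R G * cls R (Biset.coset (diag N)) := by
  refine mul_eTilde_eq_self hG _ fun K hK => ?_
  rw [mul_assoc, mul_eq_prod (cls R _), prod_coset R _ _ (p₂_diag N)]
  refine eTilde_prod_coset_eq_zero R hG _ fun h => hK (frattini_nongenerating ?_)
  refine eq_top_iff.2 (h ▸ fun a ha => ?_)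
  obtain ⟨b, k, hk, hb⟩ := mem_p₁.1 ha
  rw [mem_diagonal] at hb
  rw [← inv_mul_cancel_right a k]
  exact Subgroup.mul_mem _ (Subgroup.mem_sup_right (hN hk)) (Subgroup.mem_sup_left hb.1)

theorem Y_diag (hG : IsUnit (Nat.card G : R)) {N : NormalSubgroup G} (hN : N.1 ≤ frattini G) :
    Y R (diag N) = eTilde R G * cls R (Biset.coset (diag N)) :=
  eTilde_mul_diag_mul_eTilde hG hN

theorem Y_diag' (hG : IsUnit (Nat.card G : R)) {N : NormalSubgroup G} (hN : N.1 ≤ frattini G) :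
    Y R (diag N) = cls R (Biset.coset (diag N)) * eTilde R G := by
  have h := congrArg (opposite R) (eTilde_mul_diag_mul_eTilde hG hN)
  simpa only [Y, mul_eq_prod, opposite_prod, opposite_eTilde, opposite_coset, swap_diag,
    ← prod_assoc] using h

/-- `[Δ_M] e · e [Δ_N] = [Δ_M] e [Δ_N] = e [Δ_M] [Δ_N]`, since `e` is idempotent and commutes with
`[Δ_M]`. -/
theorem Y_diag_mul (hG : IsUnit (Nat.card G : R)) {M N : NormalSubgroup G}
    (hM : M.1 ≤ frattini G) (hN : N.1 ≤ frattini G) :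
    Y R (diag M) * Y R (diag N) = Y R (diag (normalSup M N)) := by
  rw [Y_diag hG (N := normalSup M N) (sup_le hM hN), Y_diag' hG hM, Y_diag hG hN,
    mul_assoc, ← mul_assoc (eTilde R G) (eTilde R G), eTilde_mul_self hG, ← mul_assoc,
    ← Y_diag' hG hM, Y_diag hG hM, mul_assoc, mul_eq_prod (cls R _), prod_coset R _ _ (p₂_diag M),
    relComp_diag]

end Absorption

/-! ### The idempotents `φ_N` and their vanishing properties. -/

section Phi

variable {G : Type u} [Group G] [Finite G] {R : Type v} [CommRing R]

theorem eTilde_mem_cutAlgebra (hG : IsUnit (Nat.card G : R)) : eTilde R G ∈ cutAlgebra R G :=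
  ⟨1, by rw [mul_one, eTilde_mul_self hG]⟩

theorem eTilde_mul_of_mem (hG : IsUnit (Nat.card G : R)) {x : RB R G G}
    (hx : x ∈ cutAlgebra R G) : eTilde R G * x = x := by
  obtain ⟨a, rfl⟩ := hx
  rw [← mul_assoc, ← mul_assoc, eTilde_mul_self hG]

theorem mul_eTilde_of_mem (hG : IsUnit (Nat.card G : R)) {x : RB R G G}
    (hx : x ∈ cutAlgebra R G) : x * eTilde R G = x := by
  obtain ⟨a, rfl⟩ := hx
  rw [mul_assoc, eTilde_mul_self hG]

theorem phi_mem_cutAlgebra (N : NormalSubgroup G) : phi R N ∈ cutAlgebra R G :=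
  sum_mem fun _ _ => (cutAlgebra R G).smul_mem _ ⟨_, rfl⟩

theorem phi_mul_Y_of_le (hG : IsUnit (Nat.card G : R)) {N Q : NormalSubgroup G}
    (hQ : Q.1 ≤ frattini G) (hQN : Q ≤ N) : phi R N * Y R (diag Q) = phi R N := by
  unfold phi
  rw [Finset.sum_mul]
  refine Finset.sum_congr rfl fun M _ => ?_
  rw [smul_mul_assoc, Y_diag_mul hG M.2.2 hQ, normalSup_eq_left (hQN.trans M.2.1)]

theorem sum_subtype_eq_sum_ite {A X : Type*} [AddCommMonoid A] [Fintype X] (p : X → Prop)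
    [Fintype {x // p x}] [DecidablePred p] (f : X → A) :
    ∑ x : {x // p x}, f x = ∑ x, if p x then f x else 0 := by
  rw [← Finset.sum_filter, Finset.sum_subtype (p := p) _ (by simp)]

/-- Multiplication by `Y_{Δ_Q}` replaces each `Y_{Δ_M}` by `Y_{Δ_{MQ}}`, so Weisner's theorem
applies: for `T ≥ Q`, `μ(N, ·)` sums to zero over `[N, T]` because `T ≠ N`. -/
theorem phi_mul_Y_of_not_le (hG : IsUnit (Nat.card G : R)) {N Q : NormalSubgroup G}
    (hQ : Q.1 ≤ frattini G) (hQN : ¬ Q ≤ N) : phi R N * Y R (diag Q) = 0 := by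
  classical
  have : Fintype (NormalSubgroup G) := Fintype.ofFinite _
  -- The sum is extended by zero to all normal subgroups. Truncation at `Φ(G)` is harmless: as `Q ≤
  -- Φ(G)`, `MQ ≤ Φ(G)` iff `M ≤ Φ(G)`.
  have h := sum_smul_join_eq_zero (fun M => if N ≤ M then moebius N M else 0)
    (fun M => normalSup M Q) Q (fun M T => normalSup_le_iff M Q T) ?_
    (fun M => if M.1 ≤ frattini G then Y R (diag M) else 0)
  · rw [← h, phi, Finset.sum_mul, sum_subtype_eq_sum_ite
      (fun M => N ≤ M ∧ M.1 ≤ frattini G)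
      (fun M => (moebius N M : R) • Y R (diag M) * Y R (diag Q))]
    refine Finset.sum_congr rfl fun M _ => ?_
    by_cases hN : N ≤ M
    · by_cases hM : M.1 ≤ frattini G
      · rw [if_pos ⟨hN, hM⟩, if_pos hN, if_pos (show (normalSup M Q).1 ≤ _ from sup_le hM hQ),
          smul_mul_assoc, Y_diag_mul hG hM hQ, Int.cast_smul_eq_zsmul]
      · have hM' : ¬ (normalSup M Q).1 ≤ frattini G := fun h => hM (le_sup_left.trans h)
        rw [if_neg fun h => hM h.2, if_neg hM', smul_zero]
    · rw [if_neg fun h => hN h.1, if_neg hN, zero_smul]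
  · intro T hT
    have h1 := sum_moebius_right N T
    rw [if_neg (show N ≠ T from fun h => hQN (h ▸ hT))] at h1
    refine Eq.trans ?_ h1
    rw [← Finset.sum_filter, Finset.filter_filter]
    simp only [and_comm]

/-- Expanding the second factor, only `N' ≤ M ≤ N` survive, each contributing `μ(N', M) φ_N`. The
coefficients add up to `1` or `0` by the defining identity of `μ`. -/
theorem phi_mul_phi (hG : IsUnit (Nat.card G : R)) {N N' : NormalSubgroup G}
    (hN : N.1 ≤ frattini G) :
    phi R N * phi R N' = open Classical in if N = N' then phi R N else 0 := by
  classical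
  have : Fintype (NormalSubgroup G) := Fintype.ofFinite _
  have h1 : phi R N * phi R N'
      = (∑ M : NormalSubgroup G with N' ≤ M ∧ M ≤ N, moebius N' M) • phi R N := by
    conv_lhs => rw [phi.eq_def R N']
    rw [Finset.mul_sum, Finset.sum_smul, Finset.sum_filter, sum_subtype_eq_sum_ite
      (fun M => N' ≤ M ∧ M.1 ≤ frattini G)
      (fun M => phi R N * ((moebius N' M : R) • Y R (diag M)))]
    refine Finset.sum_congr rfl fun M _ => ?_
    by_cases h' : N' ≤ M
    · by_cases hM : M.1 ≤ frattini G
      · rw [if_pos ⟨h', hM⟩, mul_smul_comm, Int.cast_smul_eq_zsmul]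
        by_cases hMN : M ≤ N
        · rw [if_pos ⟨h', hMN⟩, phi_mul_Y_of_le hG hM hMN]
        · rw [if_neg fun h => hMN h.2, phi_mul_Y_of_not_le hG hM hMN, smul_zero]
      · rw [if_neg fun h => hM h.2, if_neg fun h => hM (le_trans (b := N.1) h.2 hN)]
    · rw [if_neg fun h => h' h.1, if_neg fun h => h' h.1]
  rw [h1, sum_moebius_right]
  by_cases h : N = N'
  · rw [if_pos h.symm, if_pos h, one_smul]
  · rw [if_neg (Ne.symm h), if_neg h, zero_smul]

theorem orthogonalIdempotents_phi (hG : IsUnit (Nat.card G : R)) :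
    OrthogonalIdempotents
      (fun N : {N : NormalSubgroup G // N.1 ≤ frattini G} => phi R N.1) where
  idem N := by
    classical
    exact (phi_mul_phi hG N.2).trans (if_pos rfl)
  ortho N N' h := by
    classical
    exact (phi_mul_phi hG N.2).trans (if_neg fun h' => h (Subtype.ext h'))

/-- After exchanging sums, the coefficient of `Y_{Δ_M}` is the sum of `μ(N, M)` over all `N ≤ M`, so
only the trivial `M` remains, and there `Y_{Δ_M} = e`. -/
theorem sum_phi (hG : IsUnit (Nat.card G : R)) :
    ∑ N : {N : NormalSubgroup G // N.1 ≤ frattini G}, phi R N.1 = eTilde R G := by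
  classical
  have : Fintype (NormalSubgroup G) := Fintype.ofFinite _
  let B : NormalSubgroup G := ⟨⊥, inferInstance⟩
  have hB : ∀ M, B ≤ M := fun M => (bot_le : ⊥ ≤ M.1)
  have hYB : Y R (diag B) = eTilde R G := by
    have hd : diag B = diagonal ⊤ := by
      ext ⟨a, b⟩
      rw [mem_diagonal]
      change a * b⁻¹ ∈ (⊥ : Subgroup G) ↔ _
      rw [Subgroup.mem_bot, mul_inv_eq_one]
      simp
    rw [Y_diag hG (N := B) bot_le, hd, coset_diagonal_top, mul_one]
  have h1 : ∑ N : {N : NormalSubgroup G // N.1 ≤ frattini G}, phi R N.1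
      = ∑ M : NormalSubgroup G, (∑ N with B ≤ N ∧ N ≤ M, moebius N M) •
        (if M.1 ≤ frattini G then Y R (diag M) else 0) := by
    rw [sum_subtype_eq_sum_ite (fun N : NormalSubgroup G => N.1 ≤ frattini G)
      (fun N => phi R N)]
    simp only [Finset.sum_smul, Finset.sum_filter]
    rw [Finset.sum_comm]
    refine Finset.sum_congr rfl fun N _ => ?_
    by_cases hN : N.1 ≤ frattini G
    · rw [if_pos hN, phi, sum_subtype_eq_sum_ite (fun M => N ≤ M ∧ M.1 ≤ frattini G)
        (fun M => (moebius N M : R) • Y R (diag M))]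
      refine Finset.sum_congr rfl fun M _ => ?_
      simp only [hB, true_and, Int.cast_smul_eq_zsmul]
      split_ifs <;> simp_all
    -- An `N` outside `Φ(G)` lies below no `M ≤ Φ(G)`, so dropping the restriction on `N` adds
    -- nothing.
    · rw [if_neg hN]
      symm
      refine Finset.sum_eq_zero fun M _ => ?_
      by_cases hNM : N ≤ M
      · rw [if_neg (show ¬ M.1 ≤ frattini G from fun h => hN (le_trans (b := M.1) hNM h)),
          smul_zero]
      · rw [if_neg fun h => hNM h.2, zero_smul]
  rw [h1, Finset.sum_eq_single_of_mem B (Finset.mem_univ _)]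
  · rw [sum_moebius_left, if_pos rfl, one_smul, if_pos (show B.1 ≤ _ from bot_le), hYB]
  · intro M _ hM
    rw [sum_moebius_left, if_neg (Ne.symm hM), zero_smul]

/-- `φ_N = φ_N e` settles a proper `p₁ L`. Otherwise `Q = k₁(L) ∩ Φ(G)` is normal, `[L]` absorbs
`[Δ_Q]` on the left, and `φ_N [Δ_Q] = φ_N Y_{Δ_Q} = 0`. -/
theorem phi_prod_coset_eq_zero (hG : IsUnit (Nat.card G : R)) (N : NormalSubgroup G)
    {H : Type u} [Group H] [Finite H] (L : Subgroup (G × H))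
    (hL : ¬ (p₁ L = ⊤ ∧ k₁ L ⊓ frattini G ≤ N.1)) :
    prod (phi R N) (cls R (Biset.coset L)) = 0 := by
  by_cases hp : p₁ L = ⊤
  · have hk : (k₁ L).Normal := by
      refine ⟨fun n hn g => ?_⟩
      -- Conjugation by `g` on `k₁ L` is realized inside `L` by conjugating with `(g, h)`.
      obtain ⟨h, hh⟩ := mem_p₁.1 (hp ▸ Subgroup.mem_top g : g ∈ p₁ L)
      rw [mem_k₁] at hn ⊢
      simpa using L.mul_mem (L.mul_mem hh hn) (L.inv_mem hh)
    let Q : NormalSubgroup G := ⟨k₁ L ⊓ frattini G, inferInstance⟩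
    have hQ : Q.1 ≤ frattini G := inf_le_right
    have h0 := phi_mul_Y_of_not_le hG (N := N) hQ fun h => hL ⟨hp, h⟩
    rw [Y_diag hG hQ, ← mul_assoc, mul_eTilde_of_mem hG (phi_mem_cutAlgebra N)] at h0
    rw [← prod_diag_coset_of_le R Q L inf_le_left, ← prod_assoc, ← mul_eq_prod, h0, zero_prod]
  · rw [← mul_eTilde_of_mem hG (phi_mem_cutAlgebra N), mul_eq_prod, prod_assoc,
      eTilde_prod_coset_eq_zero R hG L hp, prod_zero]

theorem opposite_phi (N : NormalSubgroup G) : opposite R (phi R N) = phi R N := by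
  unfold phi Y
  simp only [map_sum, map_smul, mul_eq_prod, opposite_prod, opposite_eTilde, opposite_coset,
    swap_diag, prod_assoc]

theorem coset_prod_phi_eq_zero (hG : IsUnit (Nat.card G : R)) (N : NormalSubgroup G)
    {H : Type u} [Group H] [Finite H] (L : Subgroup (H × G))
    (hL : ¬ (p₂ L = ⊤ ∧ k₂ L ⊓ frattini G ≤ N.1)) :
    prod (cls R (Biset.coset L)) (phi R N) = 0 := by
  rw [← opposite_opposite R (prod _ _), opposite_prod, opposite_phi, opposite_coset,
    phi_prod_coset_eq_zero hG N (swap L) (by rwa [p₁_swap, k₁_swap]), map_zero]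

end Phi

end DoubleBurnside

theorem mainTheorem7 (R : Type v) [CommRing R] (G : Type u) [Group G] [Finite G]
    (hG : IsUnit (Nat.card G : R)) :
    -- `𝓔(G)` is an algebra with identity element `ẽ_G^G`
    (eTilde R G ∈ cutAlgebra R G ∧
      ∀ x ∈ cutAlgebra R G, eTilde R G * x = x ∧ x * eTilde R G = x) ∧
    -- the `φ_N^G` are orthogonal idempotents of `𝓔(G)`, with sum `ẽ_G^G`
    (∀ N : {N : NormalSubgroup G // N.1 ≤ frattini G}, phi R N.1 ∈ cutAlgebra R G) ∧
    OrthogonalIdempotents (fun N : {N : NormalSubgroup G // N.1 ≤ frattini G} => phi R N.1) ∧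
    ∑ N : {N : NormalSubgroup G // N.1 ≤ frattini G}, phi R N.1 = eTilde R G ∧
    -- vanishing of products with transitive bisets, on either side
    ∀ N : NormalSubgroup G, N.1 ≤ frattini G →
      ∀ (H : Type u) [Group H] [Finite H],
        (∀ L : Subgroup (G × H), ¬ (p₁ L = ⊤ ∧ k₁ L ⊓ frattini G ≤ N.1) →
          prod (phi R N) (cls R (Biset.coset L)) = 0) ∧
        (∀ L' : Subgroup (H × G), ¬ (p₂ L' = ⊤ ∧ k₂ L' ⊓ frattini G ≤ N.1) →
          prod (cls R (Biset.coset L')) (phi R N) = 0) := by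
  refine ⟨⟨eTilde_mem_cutAlgebra hG, fun x hx => ⟨eTilde_mul_of_mem hG hx,
    mul_eTilde_of_mem hG hx⟩⟩, fun N => phi_mem_cutAlgebra N.1, orthogonalIdempotents_phi hG,
    sum_phi hG, fun N _ H _ _ => ⟨fun L hL => phi_prod_coset_eq_zero hG N L hL,
      fun L hL => coset_prod_phi_eq_zero hG N L hL⟩⟩
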